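/- For $n\ge 1$ let $J_n$ be the $n\times n$ matrix with $1$s in positions $(i,i)$ and $(i,i+1)$ and $0$s elsewhere. For $1\le r\le s$ and a prime $p$ let $\lambda(r,s,p)=(\lambda_1\ge\dots\ge\lambda_n>0)$ be the partition of $rs$ such that $J_r\otimes J_s$ is similar over $\mathbb F_p$ to $J_{\lambda_1}\oplus\dots\oplus J_{\lambda_n}$, and let $\varepsilon(r,s,p)=(\lambda_1-s,\dots,\lambda_n-s)$. The negative reverse of $(v_1,\dots,v_n)$ is $(-v_n,\dots,-v_1)$. Let $q_r(p)$ be the least power $p^m$ ($m\ge 0$) of $p$ with $p^m\ge r$. **Theorem.** (0) The vector $\varepsilon(r,s,p)$ is well defined: for all $1\le r\le s$ and all primes $p$, $\lambda(r,s,p)$ exists and has exactly $r$ parts, and over every field of characteristic $p$ it is the one and only partition describing the Jordan form of $J_r\otimes J_s$ as above. For each fixed $r\ge1$, a finite computation determines $\varepsilon(r,s,p)$ for all $s\ge r$ and all primes $p$. Precisely, there are computable functions $N,B\colon\mathbb N\to\mathbb N$ and an algorithm which, on input $r$, outputs a finite list $T_r$ of triples $(s,p,v)$, such that for every $r\ge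 1$: 1. For each $(s,p,v)\in T_r$ we have $r\le s\le B(r)$, $p$ is a prime with $p\le B(r)$, and $v=\varepsilon(r,s,p)$. 2. For all $s,s'\ge r$ and all primes $p,p'$: (a) if $s\not\equiv 0,\pm1,\dots,\pm(r-2)\pmod p$ (no condition if $r=1$), then $\varepsilon(r,s,p)=(r-1,r-3,\dots,-(r-3),-(r-1))$; (b) if $s\equiv s'\pmod{q_r(p)}$, then $\varepsilon(r,s,p)=\varepsilon(r,s',p)$; (c) if $s\equiv -s'\pmod{q_r(p)}$, then $\varepsilon(r,s,p)$ is the negative reverse of $\varepsilon(r,s',p)$; (d) if $p,p'\ge N(r)$ and $s'\equiv k\pmod{p'}$ for an integer $0\le k\le r-2$, then $\varepsilon(r,s,p)=\varepsilon(r,s',p')$ when $s\equiv k\pmod p$, and $\varepsilon(r,s,p)$ is the negative reverse of $\varepsilon(r,s',p')$ when $s\equiv -k\pmod p$. 3. For all $s\ge r$ and all primes $p$, either (a) applies to $(s,p)$, or $T_r$ contains a triple $(s',p',v)$ such that one of (b) (with $p=p'$), (c) (with $p=p'$) or (d) applies to $(s,p)$ and $(s',p')$. Hence $\varepsilon(r,s,p)$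 is the vector in (a), or is $v$ or the negative reverse of $v$, as given by the rule that applies. -/

import Mathlib

open scoped Kronecker

/-- The `n × n` matrix `J_n` with `1` in the positions `(i, i)` and `(i, i + 1)`, and `0`
elsewhere. -/
def unipotentBlock (F : Type*) [CommRing F] (n : ℕ) : Matrix (Fin n) (Fin n) F :=
  Matrix.of fun i j => if (j : ℕ) = i ∨ (j : ℕ) = i + 1 then 1 else 0

/-- The direct sum `J_{l₁} ⊕ ⋯ ⊕ J_{lₙ}` for a list `l = (l₁, …, lₙ)`. -/
def unipotentSum (F : Type*) [CommRing F] (l : List ℕ) :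
    Matrix (Σ i : Fin l.length, Fin (l.get i)) (Σ i : Fin l.length, Fin (l.get i)) F :=
  Matrix.blockDiagonal' fun i : Fin l.length => unipotentBlock F (l.get i)

/-- `l = (l₁ ≥ ⋯ ≥ lₙ > 0)` and `J_r ⊗ J_s` is similar over `F` to `J_{l₁} ⊕ ⋯ ⊕ J_{lₙ}`.
The matrix `P` is the change of basis and `Q` is its inverse. -/
def IsJordanPartition (F : Type*) [CommRing F] (r s : ℕ) (l : List ℕ) : Prop :=
  l.Pairwise (· ≥ ·) ∧ (∀ a ∈ l, 0 < a) ∧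
    ∃ (P : Matrix (Fin r × Fin s) (Σ i : Fin l.length, Fin (l.get i)) F)
      (Q : Matrix (Σ i : Fin l.length, Fin (l.get i)) (Fin r × Fin s) F),
      P * Q = 1 ∧ Q * P = 1 ∧
        (unipotentBlock F r ⊗ₖ unipotentBlock F s) * P = P * unipotentSum F l

open Classical in
/-- The partition `λ(r, s, p)` given by the Jordan form of `J_r ⊗ J_s` over the field with `p`
elements. -/
noncomputable def jordanPartition (r s p : ℕ) : List ℕ :=
  if h : ∃ l, IsJordanPartition (ZMod p) r s l then h.choose else []

/-- The deviation vector `ε(r, s, p)`, with entries `λᵢ - s`. -/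
noncomputable def deviation (r s p : ℕ) : List ℤ :=
  (jordanPartition r s p).map fun a => (a : ℤ) - (s : ℤ)

/-- The negative reverse `(-vᵣ, …, -v₁)` of `(v₁, …, vᵣ)`. -/
def negReverse (v : List ℤ) : List ℤ := v.reverse.map fun a => -a

/-- The vector `(r - 1, r - 3, …, -(r - 3), -(r - 1))`: the deviation of the standard partition
`(s + r - 1, s + r - 3, …, s - r + 1)` from `(s, …, s)`. -/
def standardDeviation (r : ℕ) : List ℤ :=
  (List.range r).map fun i => (r : ℤ) - 1 - 2 * (i : ℤ)

/-- `s ≢ 0, ±1, …, ±(r - 2) (mod p)`; there is no condition when `r = 1`. -/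
def StandardCongruence (r s p : ℕ) : Prop :=
  ∀ k : ℕ, k + 2 ≤ r → ¬ (s : ℤ) ≡ (k : ℤ) [ZMOD p] ∧ ¬ (s : ℤ) ≡ -(k : ℤ) [ZMOD p]

/-- The least power of `p` that is at least `r`. -/
def leastPower (r p : ℕ) : ℕ := p ^ Nat.clog p r

/-- The pairs `(s, p)` and `(s', p')` have the same residue: either `p = p'` and `s ≡ s'` modulo
the least power of `p` that is at least `r`, or both primes are at least `N` and there is
`0 ≤ k ≤ r - 2` with `s ≡ k (mod p)` and `s' ≡ k (mod p')`. -/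
def SameResidue (r N s p s' p' : ℕ) : Prop :=
  (p = p' ∧ (s : ℤ) ≡ (s' : ℤ) [ZMOD leastPower r p]) ∨
    (N ≤ p ∧ N ≤ p' ∧
      ∃ k : ℕ, k + 2 ≤ r ∧ (s : ℤ) ≡ (k : ℤ) [ZMOD p] ∧ (s' : ℤ) ≡ (k : ℤ) [ZMOD p'])

/-- The pairs `(s, p)` and `(s', p')` have opposite residues: as before, with `s ≡ -s'`, or
with `s ≡ -k (mod p)` and `s' ≡ k (mod p')`. -/
def OppositeResidue (r N s p s' p' : ℕ) : Prop :=
  (p = p' ∧ (s : ℤ) ≡ -(s' : ℤ) [ZMOD leastPower r p]) ∨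
    (N ≤ p ∧ N ≤ p' ∧
      ∃ k : ℕ, k + 2 ≤ r ∧ (s : ℤ) ≡ -(k : ℤ) [ZMOD p] ∧ (s' : ℤ) ≡ (k : ℤ) [ZMOD p'])

/-!
The nilpotent parts of `J_r` and `J_s` make the space on which `J_r ⊗ J_s` acts into the algebra
`A = F[x, y] / (x ^ r, y ^ s)`, on which `J_r ⊗ J_s - 1` is the multiplication by
`T = x + y + x y`. With the unit `u = 1 + y` and `z = y / u` one has `z ^ s = 0` and
`T = u (x + z)`, so that forms in `x` and `z` govern the Jordan strings of `T`.

Let `r ≤ s`. Mark an index `0 ≤ k ≤ r` if `(x + z) ^ (r + s - 2 k)` is injective from degree `k - 1`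
to degree `r + s - k - 1`. In dehomogenized form this says that `(1 + X) ^ (r + s - 2 k)` has no
degenerate Padé approximant of type `(r - k - 1, k - 1)` (`DegeneratePade`). The indices `0` and `r`
are marked. If `k < k'` are consecutive marked indices, then there is a form `f` of degree `k`, not
divisible by `x + z`, which `(x + z) ^ (r + s - k - k')` kills
(`exists_generator_of_consecutive`). A dimension count gives `f` with a slightly larger exponent;
each unmarked index after `k` provides a second relation, and eliminating between the two relations
shows that the first one is divisible by `x + z` (`exists_relation_succ`). The elements `f x ^ i`
with `0 ≤ i < k' - k`, for all `k`, generate `A` modulo `T A`, and the lengths `r + s - k - k'` of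
their strings add up to `r s`; by Nakayama's lemma for the nilpotent element `T` the strings form a
basis (`isJordanPartition_markedPartition`). So the parts are the numbers `r + s - k - k'`, each
`k' - k` times. The kernels of the powers of `J_r ⊗ J_s - 1` show that no other partition is
possible (`IsJordanPartition.eq`).

It remains to study the set of marked indices. A degenerate approximant is a solution of a square
linear system with binomial coefficients, so only the characteristic `p` matters
(`degeneratePade_iff_det`). As `(1 + X) ^ q ≡ 1` modulo `X ^ r` for every power `q ≥ r` of `p`, the
set depends on `s` modulo `q` only, and inverting the power of `1 + X` reflects it under
`k ↦ r - k` when `s` is replaced by `-s` (`degeneratePade_congr`, `degeneratePade_symm`). If `p`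
divides no integer at distance at most `r - 2` from `s`, then differentiating `r - k` times shows
that all indices are marked (`not_degeneratePade_of_descFactorial_ne_zero`). For `s ≡ k` with a
small `k` and large `p`, the determinants are those of small exponents, and `p` divides them only if
they vanish (`deviation_eq_of_large`).

The set of marked indices is found by a bounded search over the coefficients of the approximants,
so the table of all `ε(r, s, p)` with `s` and `p` below an explicit bound is primitive recursive.
Bertrand's postulate provides a prime above the threshold that is small enough for the table.
-/

/-! ### Degenerate Padé approximants of `(1 + X) ^ N` -/

open Polynomial in
/-- The power series `(1 + X) ^ N` has a degenerate Padé approximant of type `(r - k - 1, k - 1)`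
over `F`: there are `g ≠ 0` of degree `< k` and `δ` of degree `< r - k` with
`(1 + X) ^ N * g ≡ δ` modulo `X ^ r`. A nondegenerate one has order of contact at most `r - 1`. -/
def DegeneratePade (F : Type*) [Field F] (r N k : ℕ) : Prop :=
  ∃ g δ : F[X], g ≠ 0 ∧ g.degree < k ∧ δ.degree < ((r - k : ℕ) : WithBot ℕ) ∧
    X ^ r ∣ (X + 1) ^ N * g - δ

section Pade

open Polynomial

variable {F : Type*} [Field F] {r N k : ℕ}

theorem isCoprime_X_pow_X_add_one_pow (a b : ℕ) : IsCoprime ((X : F[X]) ^ a) ((X + 1) ^ b) :=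
  IsCoprime.pow ⟨-1, 1, by ring⟩

theorem not_degeneratePade_zero : ¬ DegeneratePade F r N 0 := by
  rintro ⟨g, δ, hg, hdeg, -⟩
  exact hg (by simpa using hdeg)

theorem not_degeneratePade_self : ¬ DegeneratePade F r N r := by
  rintro ⟨g, δ, hg, hdeg, hδ, h⟩
  have hδ0 : δ = 0 := by simpa using hδ
  rw [hδ0, sub_zero] at h
  have h2 := (isCoprime_X_pow_X_add_one_pow r N).dvd_of_dvd_mul_left h
  exact hg (eq_zero_of_dvd_of_degree_lt h2 (by simpa using hdeg))

/-- Since `(1 + X) ^ q = 1 + X ^ q` for a power `q` of the characteristic, the truncation of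
`(1 + X) ^ N` modulo `X ^ r` is periodic in `N` with period `q ≥ r`. -/
theorem X_pow_dvd_X_add_one_pow_sub_one {p m : ℕ} [Fact p.Prime] [CharP F p] (hq : r ≤ p ^ m)
    (c : ℕ) : (X : F[X]) ^ r ∣ (X + 1) ^ (p ^ m * c) - 1 := by
  rw [pow_mul]
  refine dvd_trans ?_ (sub_one_dvd_pow_sub_one _ c)
  rw [add_pow_char_pow, one_pow, add_sub_cancel_right]
  exact pow_dvd_pow _ hq

theorem degeneratePade_add_mul {p m : ℕ} [Fact p.Prime] [CharP F p] (hq : r ≤ p ^ m) (c : ℕ) :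
    DegeneratePade F r (N + p ^ m * c) k ↔ DegeneratePade F r N k := by
  have key (g δ : F[X]) : X ^ r ∣ (X + 1) ^ (N + p ^ m * c) * g - δ ↔
      X ^ r ∣ (X + 1) ^ N * g - δ := by
    have h := (X_pow_dvd_X_add_one_pow_sub_one (F := F) hq c).mul_left ((X + 1) ^ N * g)
    rw [← dvd_add_right h (c := (X + 1) ^ N * g - δ)]
    ring_nf
  simp only [DegeneratePade, key]

theorem degeneratePade_congr {p m N' : ℕ} [Fact p.Prime] [CharP F p] (hq : r ≤ p ^ m)
    (h : N ≡ N' [MOD p ^ m]) : DegeneratePade F r N k ↔ DegeneratePade F r N' k := by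
  wlog hle : N ≤ N' generalizing N N'
  · exact (this h.symm (by omega)).symm
  obtain ⟨c, hc⟩ := (Nat.modEq_iff_dvd' hle).1 h
  obtain rfl : N' = N + p ^ m * c := by omega
  exact (degeneratePade_add_mul hq c).symm

/-- Multiplying `(1 + X) ^ N * g ≡ δ` by the inverse power of `1 + X` exchanges the roles of `g`
and `δ`. -/
theorem DegeneratePade.symm {p m N' : ℕ} [Fact p.Prime] [CharP F p] (hq : r ≤ p ^ m)
    (hk : k ≤ r) (h : p ^ m ∣ N + N') (hD : DegeneratePade F r N k) :
    DegeneratePade F r N' (r - k) := by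
  obtain ⟨g, δ, hg, hdeg, hδ, hdvd⟩ := hD
  obtain ⟨c, hc⟩ := h
  refine ⟨δ, g, ?_, hδ, by rwa [Nat.sub_sub_self hk], ?_⟩
  · rintro rfl
    rw [sub_zero] at hdvd
    have h2 := (isCoprime_X_pow_X_add_one_pow r N).dvd_of_dvd_mul_left hdvd
    refine hg (eq_zero_of_dvd_of_degree_lt h2 (hdeg.trans_le ?_))
    simpa using hk
  · have h1 := (X_pow_dvd_X_add_one_pow_sub_one (F := F) hq c).mul_left g
    have h2 := hdvd.mul_left ((X + 1) ^ N')
    rw [← hc] at h1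
    convert dvd_sub h1 h2 using 1
    ring

theorem degeneratePade_symm {p m N' : ℕ} [Fact p.Prime] [CharP F p] (hq : r ≤ p ^ m)
    (hk : k ≤ r) (h : p ^ m ∣ N + N') :
    DegeneratePade F r N k ↔ DegeneratePade F r N' (r - k) := by
  refine ⟨fun hD => hD.symm hq hk h, fun hD => ?_⟩
  have := hD.symm (N' := N) hq (Nat.sub_le _ _) (by rwa [add_comm])
  rwa [Nat.sub_sub_self hk] at this

/-- The matrix of binomial coefficients that governs the Padé approximants of `(1 + X) ^ N`: its
column `j` lists the coefficients of `(1 + X) ^ N * X ^ j` in degrees `r - k, …, r - 1`. -/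
def padeMatrix (r N k : ℕ) : Matrix (Fin k) (Fin k) ℤ :=
  Matrix.of fun i j =>
    if (j : ℕ) ≤ r - k + i then ((N.choose (r - k + i - j) : ℕ) : ℤ) else 0

theorem exists_X_pow_dvd_sub_of_coeff_eq_zero {P : F[X]} {a : ℕ}
    (h : ∀ d, a ≤ d → d < r → P.coeff d = 0) :
    ∃ δ : F[X], δ.degree < a ∧ X ^ r ∣ P - δ := by
  refine ⟨∑ i ∈ Finset.range a, monomial i (P.coeff i), ?_, X_pow_dvd_iff.2 fun d hd => ?_⟩
  · rw [← mem_degreeLT]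
    refine Submodule.sum_mem _ fun i hi => mem_degreeLT.2 ?_
    refine (degree_monomial_le _ _).trans_lt ?_
    exact_mod_cast Finset.mem_range.1 hi
  · rw [coeff_sub, finsetSum_coeff]
    simp only [coeff_monomial, Finset.sum_ite_eq', Finset.mem_range]
    split_ifs with hdk
    · simp
    · rw [h d (by omega) hd, sub_zero]

theorem degeneratePade_iff_coeff (hk : k ≤ r) : DegeneratePade F r N k ↔
    ∃ g : F[X], g ≠ 0 ∧ g.degree < k ∧ ∀ i < k, ((X + 1) ^ N * g).coeff (r - k + i) = 0 := by
  constructor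
  · rintro ⟨g, δ, hg, hdeg, hδ, hdvd⟩
    refine ⟨g, hg, hdeg, fun i hi => ?_⟩
    have h1 := X_pow_dvd_iff.1 hdvd (r - k + i) (by omega)
    rw [coeff_sub, sub_eq_zero] at h1
    rw [h1]
    refine coeff_eq_zero_of_degree_lt (hδ.trans_le ?_)
    exact_mod_cast Nat.le_add_right _ _
  · rintro ⟨g, hg, hdeg, h⟩
    obtain ⟨δ, hδ, hdvd⟩ := exists_X_pow_dvd_sub_of_coeff_eq_zero (r := r) (a := r - k)
      (P := (X + 1) ^ N * g) fun d hd hdr => by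
        have := h (d - (r - k)) (by omega)
        rwa [Nat.add_sub_cancel' hd] at this
    exact ⟨g, δ, hg, hdeg, hδ, hdvd⟩

theorem coeff_X_add_one_pow_mul_sum (c : ℕ → F) (d : ℕ) :
    ((X + 1) ^ N * ∑ j ∈ Finset.range k, C (c j) * X ^ j).coeff d =
      ∑ j ∈ Finset.range k, (if j ≤ d then ((N.choose (d - j) : ℕ) : F) else 0) * c j := by
  rw [Finset.mul_sum, finsetSum_coeff]
  refine Finset.sum_congr rfl fun j _ => ?_
  rw [mul_left_comm, coeff_C_mul, coeff_mul_X_pow', coeff_X_add_one_pow, mul_comm]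

theorem degeneratePade_iff_exists_coeff (hk : k ≤ r) : DegeneratePade F r N k ↔
    ∃ c : ℕ → F, (∃ j < k, c j ≠ 0) ∧ ∀ i < k, ∑ j ∈ Finset.range k,
      (if j ≤ r - k + i then ((N.choose (r - k + i - j) : ℕ) : F) else 0) * c j = 0 := by
  rw [degeneratePade_iff_coeff hk]
  constructor
  · rintro ⟨g, hg, hdeg, h⟩
    have hsum : g = ∑ j ∈ Finset.range k, C (g.coeff j) * X ^ j := by
      by_cases hk0 : k = 0
      · subst hk0
        exact absurd (by simpa using hdeg) hg
      · exact as_sum_range_C_mul_X_pow' _ ((natDegree_lt_iff_degree_lt hg).2 hdeg)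
    refine ⟨g.coeff, ?_, fun i hi => ?_⟩
    · by_contra! hcon
      refine hg (hsum.trans (Finset.sum_eq_zero fun j hj => ?_))
      rw [hcon j (Finset.mem_range.1 hj)]
      simp
    · rw [← coeff_X_add_one_pow_mul_sum, ← hsum]
      exact h i hi
  · rintro ⟨c, ⟨j, hj, hcj⟩, h⟩
    refine ⟨∑ j ∈ Finset.range k, C (c j) * X ^ j, fun h0 => hcj ?_, ?_, fun i hi => ?_⟩
    · have := congrArg (fun q => q.coeff j) h0
      simpa [finsetSum_coeff, coeff_C_mul, coeff_X_pow, hj] using this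
    · rw [← mem_degreeLT]
      refine Submodule.sum_mem _ fun i hi => mem_degreeLT.2 ?_
      refine (degree_C_mul_X_pow_le _ _).trans_lt ?_
      exact_mod_cast Finset.mem_range.1 hi
    · rw [coeff_X_add_one_pow_mul_sum]
      exact h i hi

theorem degeneratePade_iff_det (hk : k ≤ r) :
    DegeneratePade F r N k ↔ (((padeMatrix r N k).det : ℤ) : F) = 0 := by
  rw [degeneratePade_iff_exists_coeff hk]
  have hdet : (((padeMatrix r N k).det : ℤ) : F) =
      ((Int.castRingHom F).mapMatrix (padeMatrix r N k)).det :=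
    RingHom.map_det (Int.castRingHom F) _
  rw [hdet, ← Matrix.exists_mulVec_eq_zero_iff]
  have hentry (c : ℕ → F) (i : Fin k) :
      ((Int.castRingHom F).mapMatrix (padeMatrix r N k)).mulVec (fun j => c j) i =
        ∑ j ∈ Finset.range k,
          (if j ≤ r - k + i then ((N.choose (r - k + i - j) : ℕ) : F) else 0) * c j := by
    rw [Finset.sum_range]
    simp only [Matrix.mulVec, dotProduct, padeMatrix, RingHom.mapMatrix_apply, Matrix.map_apply,
      Matrix.of_apply]
    refine Finset.sum_congr rfl fun j _ => ?_
    split_ifs <;> simp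
  constructor
  · rintro ⟨c, ⟨j, hj, hcj⟩, h⟩
    refine ⟨fun j => c j, fun h0 => hcj (congrFun h0 ⟨j, hj⟩), ?_⟩
    ext i
    rw [hentry]
    exact h i i.2
  · rintro ⟨v, hv, h⟩
    have hv' : v = fun j : Fin k => (fun n => if hn : n < k then v ⟨n, hn⟩ else 0) (j : ℕ) := by
      ext j; simp
    refine ⟨fun n => if hn : n < k then v ⟨n, hn⟩ else 0, ?_, fun i hi => ?_⟩
    · obtain ⟨j, hj⟩ := Function.ne_iff.1 hv
      exact ⟨j, j.2, by simpa using hj⟩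
    · rw [← hentry _ ⟨i, hi⟩, ← hv', h]
      rfl

theorem degeneratePade_iff_zmod {p : ℕ} [Fact p.Prime] [CharP F p] (hk : k ≤ r) :
    DegeneratePade F r N k ↔ DegeneratePade (ZMod p) r N k := by
  rw [degeneratePade_iff_det hk, degeneratePade_iff_det hk, CharP.intCast_eq_zero_iff F p,
    CharP.intCast_eq_zero_iff (ZMod p) p]

/-- If the rising factors `(N + i) (N + i - 1) ⋯ (N + i - (r - k) + 1)`, `i < k`, are nonzero in
`F`, then the Padé approximant is not degenerate: in terms of `Y = 1 + X`, the `(r - k)`-th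
derivative kills `δ` and multiplies the coefficients of `Y ^ N * g` by these factors, and it leaves
a contact of order `k` at `Y = 1`, too much for a polynomial of degree `< k`. -/
theorem not_degeneratePade_of_descFactorial_ne_zero (hk : k ≤ r)
    (h : ∀ i < k, (((N + i).descFactorial (r - k) : ℕ) : F) ≠ 0) :
    ¬ DegeneratePade F r N k := by
  rintro ⟨g, δ, hg, hdeg, hδ, hdvd⟩
  set m := r - k with hm
  set G := taylor (-1 : F) g with hG
  have hG0 : G ≠ 0 := fun h0 => hg ((taylor_injective (-1 : F)) (by rw [← hG, h0, map_zero]))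
  have hGdeg : G.degree < k := by rwa [hG, degree_taylor]
  have hdvd' : (X - 1 : F[X]) ^ r ∣ X ^ N * G - taylor (-1 : F) δ := by
    have := map_dvd (taylorAlgHom (-1 : F)) hdvd
    simpa [taylor_X, ← sub_eq_add_neg] using this
  have hD := pow_sub_dvd_iterate_derivative_of_pow_dvd m hdvd'
  have hδ0 : derivative^[m] (taylor (-1 : F) δ) = 0 := by
    by_cases hδ' : δ = 0
    · simp [hδ']
    · refine iterate_derivative_eq_zero ?_
      rw [natDegree_taylor]
      exact (natDegree_lt_iff_degree_lt hδ').2 hδ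
  rw [iterate_derivative_sub, hδ0, sub_zero, show r - m = k by omega] at hD
  have hk0 : k ≠ 0 := by
    rintro rfl
    exact hg (by simpa using hdeg)
  have hsum : G = ∑ j ∈ Finset.range k, C (G.coeff j) * X ^ j :=
    as_sum_range_C_mul_X_pow' _ ((natDegree_lt_iff_degree_lt hG0).2 hGdeg)
  set H : F[X] := ∑ j ∈ Finset.range k, C (((N + j).descFactorial m : ℕ) * G.coeff j) * X ^ j
    with hH
  have hmul : X ^ m * derivative^[m] (X ^ N * G) = X ^ N * H := by
    conv_lhs => rw [hsum]
    rw [Finset.mul_sum, iterate_derivative_sum, Finset.mul_sum, hH, Finset.mul_sum]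
    refine Finset.sum_congr rfl fun j _ => ?_
    rw [mul_left_comm, ← pow_add, iterate_derivative_C_mul,
      iterate_derivative_X_pow_eq_natCast_mul]
    by_cases hmj : m ≤ N + j
    · have : (X : F[X]) ^ m * X ^ (N + j - m) = X ^ N * X ^ j := by
        rw [← pow_add, ← pow_add]; congr 1; omega
      rw [C_mul, C_eq_natCast]
      linear_combination C (G.coeff j) * ((N + j).descFactorial m : F[X]) * this
    · rw [Nat.descFactorial_eq_zero_iff_lt.2 (by omega)]
      simp
  have hcop : IsCoprime ((X - 1 : F[X]) ^ k) (X ^ N) := IsCoprime.pow ⟨-1, 1, by ring⟩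
  have hHdvd : (X - 1 : F[X]) ^ k ∣ H :=
    hcop.dvd_of_dvd_mul_left (hmul ▸ hD.mul_left (X ^ m))
  have hH0 : H = 0 := by
    refine eq_zero_of_dvd_of_degree_lt hHdvd ?_
    rw [degree_pow, ← C_1, degree_X_sub_C, nsmul_one, ← mem_degreeLT]
    refine Submodule.sum_mem _ fun i hi => mem_degreeLT.2 ?_
    refine (degree_C_mul_X_pow_le _ _).trans_lt ?_
    exact_mod_cast Finset.mem_range.1 hi
  refine hG0 (hsum.trans (Finset.sum_eq_zero fun j hj => ?_))
  have := congrArg (fun q => q.coeff j) hH0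
  have hj' := Finset.mem_range.1 hj
  simp only [hH, finsetSum_coeff, coeff_C_mul, coeff_X_pow, coeff_zero, mul_ite, mul_one,
    mul_zero, Finset.sum_ite_eq, hj, if_true] at this
  rw [(mul_eq_zero.1 this).resolve_left (h j hj')]
  simp

end Pade

/-! ### Relations between forms in two variables -/

section Syzygy

open Polynomial

variable {F : Type*} [Field F] {r s k l : ℕ}

theorem Polynomial.degree_mul_lt_of_add_le {p q : F[X]} {a b c : ℕ} (hp : p.degree < a)
    (hq : q.degree < b) (h : a + b ≤ c + 1) : (p * q).degree < c := by
  by_cases hp0 : p = 0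
  · simp [hp0]
  by_cases hq0 : q = 0
  · simp [hq0]
  have h1 := (natDegree_lt_iff_degree_lt hp0).2 hp
  have h2 := (natDegree_lt_iff_degree_lt hq0).2 hq
  refine (natDegree_lt_iff_degree_lt (mul_ne_zero hp0 hq0)).1 ?_
  rw [natDegree_mul hp0 hq0]
  omega

theorem Polynomial.degree_X_add_one_pow_lt (n : ℕ) :
    ((X + 1 : F[X]) ^ n).degree < ((n + 1 : ℕ) : WithBot ℕ) := by
  rw [degree_pow, ← C_1, degree_X_add_C, nsmul_one]
  exact_mod_cast Nat.lt_succ_self n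

theorem Polynomial.X_add_one_dvd_iff {p : F[X]} : X + 1 ∣ p ↔ p.eval (-1) = 0 := by
  rw [← IsRoot.def, ← dvd_iff_isRoot]
  simp

theorem Polynomial.degree_lt_of_X_add_one_pow_mul {p : F[X]} {a b n : ℕ}
    (h : ((X + 1 : F[X]) ^ n * p).degree < (a : WithBot ℕ)) (hb : a ≤ b + n) : p.degree < b := by
  by_cases hp0 : p = 0
  · simp [hp0]
  have hX : (X + 1 : F[X]) ^ n ≠ 0 := pow_ne_zero _ (X_add_C_ne_zero (1 : F))
  have h1 := (natDegree_lt_iff_degree_lt (mul_ne_zero hX hp0)).2 h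
  have h2 : ((X + 1 : F[X]) ^ n).natDegree = n := by
    rw [natDegree_pow, ← C_1, natDegree_X_add_C, mul_one]
  rw [natDegree_mul hX hp0, h2] at h1
  exact (natDegree_lt_iff_degree_lt hp0).1 (by omega)

/-- The polynomial `f`, a dehomogenized form of degree `k`, has `k + 1` coefficients, and the
relation imposes `k` linear conditions on them. If `X + 1` divided `f`, the quotient would give a
degenerate approximant of index `k`. -/
theorem exists_generator (hk : k < r) (hrs : r ≤ s)
    (hD : ¬ DegeneratePade F r (r + s - 2 * k) k) :
    ∃ f : F[X], f.degree < ((k + 1 : ℕ) : WithBot ℕ) ∧ f.eval (-1) ≠ 0 ∧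
      ∃ β : F[X], β.degree < ((r - k : ℕ) : WithBot ℕ) ∧
        X ^ r ∣ (X + 1) ^ (r + s - 2 * k - 1) * f - β := by
  let φ : degreeLT F (k + 1) →ₗ[F] (Fin k → F) :=
    (LinearMap.pi fun i : Fin k => lcoeff F (r - k + i)) ∘ₗ
      LinearMap.mulLeft F ((X + 1 : F[X]) ^ (r + s - 2 * k - 1)) ∘ₗ (degreeLT F (k + 1)).subtype
  have : FiniteDimensional F (degreeLT F (k + 1)) :=
    Module.Finite.equiv (degreeLTEquiv F (k + 1)).symm
  have hker : LinearMap.ker φ ≠ ⊥ := by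
    apply LinearMap.ker_ne_bot_of_finrank_lt
    rw [(degreeLTEquiv F (k + 1)).finrank_eq]
    simp
  obtain ⟨f, hf, hf0⟩ := Submodule.exists_mem_ne_zero_of_ne_bot hker
  have hfdeg := mem_degreeLT.1 f.2
  have hcoeff (d : ℕ) (hd : r - k ≤ d) (hdr : d < r) :
      ((X + 1 : F[X]) ^ (r + s - 2 * k - 1) * f).coeff d = 0 := by
    have := congrFun (LinearMap.mem_ker.1 hf) ⟨d - (r - k), by omega⟩
    simpa [φ, Nat.add_sub_cancel' hd] using this
  obtain ⟨β, hβ, hdvd⟩ := exists_X_pow_dvd_sub_of_coeff_eq_zero hcoeff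
  refine ⟨f, hfdeg, fun h0 => hD ?_, β, hβ, hdvd⟩
  obtain ⟨g, hg⟩ := X_add_one_dvd_iff.2 h0
  refine ⟨g, β, ?_, ?_, hβ, ?_⟩
  · rintro rfl
    exact hf0 (Subtype.ext (by simpa using hg))
  · exact degree_lt_of_X_add_one_pow_mul (n := 1) (by rwa [pow_one, ← hg]) le_rfl
  · convert hdvd using 2
    rw [hg, ← mul_assoc, ← pow_succ]
    congr 2
    omega

/-- Two relations `Y ^ n f = X ^ r α + β` and `Y ^ (n - m) g = X ^ r γ + δ`, where `Y = X + 1`, of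
small degree give `α g = Y ^ m f γ` and `β g = Y ^ m f δ`. As `Y ^ m` does not divide `g`, both `α`
and `β` are divisible by the prime `Y`, and the first relation can be divided by `Y`. -/
theorem exists_relation_succ (hkl : k < l) (hlr : l < r) (hrs : r ≤ s)
    (hDk : ¬ DegeneratePade F r (r + s - 2 * k) k) (hDl : DegeneratePade F r (r + s - 2 * l) l)
    {f : F[X]} (hf : f.degree < ((k + 1 : ℕ) : WithBot ℕ))
    (h : ∃ β : F[X], β.degree < ((r - l + 1 : ℕ) : WithBot ℕ) ∧
      X ^ r ∣ (X + 1) ^ (r + s - k - l) * f - β) :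
    ∃ β : F[X], β.degree < ((r - l : ℕ) : WithBot ℕ) ∧
      X ^ r ∣ (X + 1) ^ (r + s - k - (l + 1)) * f - β := by
  obtain ⟨β, hβ, α, hα⟩ := h
  obtain ⟨g, δ, hg0, hg, hδ, γ, hγ⟩ := hDl
  have hY : (X + 1 : F[X]) ≠ 0 := X_add_C_ne_zero (1 : F)
  have hprime : Prime (X + 1 : F[X]) := by
    simpa using prime_X_sub_C (-1 : F)
  -- eliminate the powers of `X + 1` between the two relations
  have hpow : (X + 1 : F[X]) ^ (r + s - k - l) = (X + 1) ^ (l - k) * (X + 1) ^ (r + s - 2 * l) := by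
    rw [← pow_add]; congr 1; omega
  have hcross : X ^ r * (α * g - (X + 1) ^ (l - k) * f * γ) =
      (X + 1) ^ (l - k) * f * δ - β * g := by
    linear_combination (-g) * hα + (X + 1) ^ (l - k) * f * hγ + f * g * hpow
  have hdeg : ((X + 1) ^ (l - k) * f * δ - β * g).degree < (r : WithBot ℕ) := by
    refine mem_degreeLT.1 (Submodule.sub_mem _ (mem_degreeLT.2 ?_) (mem_degreeLT.2 ?_))
    · refine degree_mul_lt_of_add_le (a := l + 1) ?_ hδ (by omega)
      exact degree_mul_lt_of_add_le (degree_X_add_one_pow_lt _) hf (by omega)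
    · exact degree_mul_lt_of_add_le hβ hg (by omega)
  have hβg : (X + 1) ^ (l - k) * f * δ - β * g = 0 :=
    eq_zero_of_dvd_of_degree_lt ⟨_, hcross.symm⟩ (by rwa [degree_X_pow])
  have hαg : α * g - (X + 1) ^ (l - k) * f * γ = 0 := by
    rw [hβg] at hcross
    exact (mul_eq_zero.1 hcross).resolve_left (pow_ne_zero _ X_ne_zero)
  have hng : ¬ (X + 1) ^ (l - k) ∣ g := by
    rintro ⟨g', rfl⟩
    refine hDk ⟨g', (X + 1) ^ (l - k) * δ, right_ne_zero_of_mul hg0,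
      degree_lt_of_X_add_one_pow_mul hg (by omega),
      degree_mul_lt_of_add_le (degree_X_add_one_pow_lt _) hδ (by omega),
      (X + 1) ^ (l - k) * γ, ?_⟩
    rw [show r + s - 2 * k = (l - k) + (l - k) + (r + s - 2 * l) by omega, pow_add, pow_add]
    linear_combination (X + 1) ^ (l - k) * hγ
  have hdvd {a b : F[X]} (hab : a * g - (X + 1) ^ (l - k) * f * b = 0) : X + 1 ∣ a := by
    by_contra hcon
    refine hng (hprime.pow_dvd_of_dvd_mul_left _ hcon ?_)
    rw [sub_eq_zero.1 hab, mul_assoc]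
    exact dvd_mul_right _ _
  obtain ⟨α', rfl⟩ := hdvd hαg
  obtain ⟨β', rfl⟩ := hdvd (a := β) (b := δ) (by linear_combination -hβg)
  refine ⟨β', ?_, α', mul_left_cancel₀ hY ?_⟩
  · exact degree_lt_of_X_add_one_pow_mul (n := 1) (by rwa [pow_one]) le_rfl
  · rw [show r + s - k - l = (r + s - k - (l + 1)) + 1 by omega, pow_succ] at hα
    linear_combination hα

/-- If `k < k'` are consecutive indices of nondegenerate approximants, the generator of index `k`
satisfies a relation of length `r + s - k - k'`. -/
theorem exists_generator_of_consecutive {k' : ℕ} (hk : k < k') (hk' : k' ≤ r) (hrs : r ≤ s)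
    (hD : ¬ DegeneratePade F r (r + s - 2 * k) k)
    (hbetween : ∀ l, k < l → l < k' → DegeneratePade F r (r + s - 2 * l) l) :
    ∃ f : F[X], f.degree < ((k + 1 : ℕ) : WithBot ℕ) ∧ f.eval (-1) ≠ 0 ∧
      ∃ β : F[X], β.degree < ((r - k' + 1 : ℕ) : WithBot ℕ) ∧
        X ^ r ∣ (X + 1) ^ (r + s - k - k') * f - β := by
  obtain ⟨f, hf, hf1, hβ⟩ := exists_generator (hk.trans_le hk') hrs hD
  refine ⟨f, hf, hf1, ?_⟩
  induction k', Nat.succ_le_of_lt hk using Nat.le_induction with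
  | base =>
    rwa [show r - (k + 1) + 1 = r - k by omega,
      show r + s - k - (k + 1) = r + s - 2 * k - 1 by omega]
  | succ l hl ih =>
    have := exists_relation_succ (by omega) (by omega) hrs hD (hbetween l (by omega) (by omega))
      hf (ih (by omega) (by omega) fun l' h1 h2 => hbetween l' h1 (by omega))
    rwa [show r - (l + 1) + 1 = r - l by omega]

end Syzygy

/-! ### Strings in a commutative algebra -/

section Homogenization

open Polynomial

variable {F : Type*} [Field F] {A : Type*} [CommRing A] [Algebra F A] {r s k : ℕ}

theorem Polynomial.natDegree_le_of_degree_lt_succ {p : F[X]} {n : ℕ}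
    (h : p.degree < ((n + 1 : ℕ) : WithBot ℕ)) : p.natDegree ≤ n := by
  by_cases hp : p = 0
  · simp [hp]
  · exact Nat.lt_succ_iff.1 ((natDegree_lt_iff_degree_lt hp).2 h)

theorem Polynomial.natDegree_X_add_one_pow_le (n : ℕ) : ((X + 1 : F[X]) ^ n).natDegree ≤ n :=
  natDegree_le_of_degree_lt_succ (degree_X_add_one_pow_lt n)

theorem Polynomial.homogenize_X_add_one_pow (n : ℕ) :
    ((X + 1 : F[X]) ^ n).homogenize n = (MvPolynomial.X 0 + MvPolynomial.X 1) ^ n := by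
  induction n with
  | zero => simp
  | succ n ih =>
    rw [pow_succ, homogenize_mul _ _ (natDegree_X_add_one_pow_le n)
      (by simpa using natDegree_X_add_one_pow_le (F := F) 1), ih, pow_succ]
    congr 1
    rw [homogenize_add, homogenize_X one_ne_zero, homogenize_one]
    simp

/-- A relation for the dehomogenized form `f` of degree `k` becomes a relation in every algebra
with elements `x`, `y` such that `x ^ r = 0` and `y ^ s = 0`. -/
theorem add_pow_mul_aeval_homogenize_eq_zero {k' : ℕ} (hk : k < k') (hk' : k' ≤ r) (hrs : r ≤ s)
    {f β : F[X]} (hf : f.degree < ((k + 1 : ℕ) : WithBot ℕ))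
    (hβ : β.degree < ((r - k' + 1 : ℕ) : WithBot ℕ))
    (h : X ^ r ∣ (X + 1) ^ (r + s - k - k') * f - β) {x y : A} (hx : x ^ r = 0) (hy : y ^ s = 0) :
    (x + y) ^ (r + s - k - k') * MvPolynomial.aeval ![x, y] (f.homogenize k) = 0 := by
  obtain ⟨α, hα⟩ := h
  have hαdeg : α.natDegree ≤ s - k' := by
    by_cases hα0 : α = 0
    · simp [hα0]
    have h1 : (X ^ r * α).degree < ((r + s - k' + 1 : ℕ) : WithBot ℕ) := by
      rw [← hα]
      refine mem_degreeLT.1 (Submodule.sub_mem _ (mem_degreeLT.2 ?_) (mem_degreeLT.2 ?_))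
      · exact degree_mul_lt_of_add_le (degree_X_add_one_pow_lt _) hf (by omega)
      · refine hβ.trans_le ?_
        exact_mod_cast (by omega : r - k' + 1 ≤ r + s - k' + 1)
    have h2 := (natDegree_lt_iff_degree_lt (mul_ne_zero (pow_ne_zero _ X_ne_zero) hα0)).2 h1
    rw [natDegree_X_pow_mul _ hα0] at h2
    omega
  have hsplit : (X + 1) ^ (r + s - k - k') * f = X ^ r * α + 1 * β := by
    rw [← hα]; ring
  have h1 := homogenize_mul _ _ (natDegree_X_add_one_pow_le (F := F) (r + s - k - k'))
    (natDegree_le_of_degree_lt_succ hf)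
  have h2 := homogenize_mul (X ^ r) α (natDegree_X_pow_le r) hαdeg
  have h3 := homogenize_mul 1 β (m := s) (by simp) (natDegree_le_of_degree_lt_succ hβ)
  rw [hsplit, homogenize_X_add_one_pow, homogenize_add,
    show r + s - k - k' + k = r + (s - k') by omega, h2,
    show r + (s - k') = s + (r - k') by omega, h3, homogenize_X_pow le_rfl, homogenize_one] at h1
  have h4 := congrArg (MvPolynomial.aeval ![x, y]) h1
  simpa [hx, hy] using h4.symm

/-- Modulo the linear form `x + y`, a form of degree `k` in `x` and `y` is a multiple of `x ^ k`. -/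
theorem exists_aeval_homogenize_sub_dvd {f : F[X]} (hf : f.degree < ((k + 1 : ℕ) : WithBot ℕ))
    (hf1 : f.eval (-1) ≠ 0) (x y : A) :
    ∃ c : F, c ≠ 0 ∧ x + y ∣ MvPolynomial.aeval ![x, y] (f.homogenize k) - c • x ^ k := by
  obtain ⟨q, hq⟩ := X_add_one_dvd_iff.2 (show (f - C (f.eval (-1))).eval (-1) = 0 by simp)
  have hqdeg : q.degree < (k : WithBot ℕ) := by
    refine degree_lt_of_X_add_one_pow_mul (n := 1) (a := k + 1) ?_ le_rfl
    rw [pow_one, ← hq]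
    refine mem_degreeLT.1 (Submodule.sub_mem _ (mem_degreeLT.2 hf) (mem_degreeLT.2 ?_))
    refine degree_C_le.trans_lt ?_
    exact_mod_cast Nat.succ_pos k
  have hfq : f = C (f.eval (-1)) + (X + 1) ^ 1 * q := by
    rw [pow_one, ← hq]; ring
  have hxy : x + y ∣ y ^ k - (-x) ^ k := by
    have := sub_dvd_pow_sub_pow y (-x) k
    rwa [sub_neg_eq_add, add_comm] at this
  have hdvd : x + y ∣ MvPolynomial.aeval ![x, y] (((X + 1) ^ 1 * q).homogenize k) := by
    rcases k with _ | k
    · have : q = 0 := by simpa using hqdeg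
      simp [this]
    · have h1 := homogenize_mul _ q (natDegree_X_add_one_pow_le (F := F) 1)
        (natDegree_le_of_degree_lt_succ hqdeg)
      rw [add_comm k 1, h1, homogenize_X_add_one_pow]
      simp
  refine ⟨f.eval (-1) * (-1) ^ k, mul_ne_zero hf1 (pow_ne_zero _ (by simp)), ?_⟩
  have hsum : MvPolynomial.aeval ![x, y] (f.homogenize k) - (f.eval (-1) * (-1) ^ k) • x ^ k =
      algebraMap F A (f.eval (-1)) * (y ^ k - (-x) ^ k) +
        MvPolynomial.aeval ![x, y] (((X + 1) ^ 1 * q).homogenize k) := by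
    conv_lhs => rw [hfq, homogenize_add, homogenize_C]
    have hneg : (-x) ^ k = (-1) ^ k * x ^ k := neg_pow x k
    rw [Algebra.smul_def, hneg]
    simp
    ring
  rw [hsum]
  exact dvd_add (hxy.mul_left _) hdvd

/-- If `x ^ r = 0`, the quotient by the ideal generated by `(1 + x) (1 + y) - 1` is spanned by the
powers `x ^ i` with `i < r`. -/
theorem pow_mul_pow_mem_of_pow_mem {x y : A} (hx : x ^ r = 0) {S : Submodule F A}
    (hT : ∀ a, (x + y + x * y) * a ∈ S) (hS : ∀ i < r, x ^ i ∈ S) (a b : ℕ) :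
    x ^ a * y ^ b ∈ S := by
  by_cases ha : r ≤ a
  · rw [pow_eq_zero_of_le ha hx, zero_mul]
    exact S.zero_mem
  · cases b with
    | zero => simpa using hS a (by omega)
    | succ b =>
      have h1 := pow_mul_pow_mem_of_pow_mem hx hT hS (a + 1) b
      have h2 := pow_mul_pow_mem_of_pow_mem hx hT hS (a + 1) (b + 1)
      have h3 := S.sub_mem (S.sub_mem (hT (x ^ a * y ^ b)) h1) h2
      convert h3 using 1
      ring
termination_by (r - a, b)

end Homogenization

section Strings

variable {F : Type*} [Field F] {A : Type*} [CommRing A] [Algebra F A]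

/-- Nakayama's lemma for a nilpotent operator: the strings `w, T w, …` that start at generators
modulo the image of `T` span everything. -/
theorem top_le_span_strings {ι : Type*} {T : A} (hT : IsNilpotent T) (w : ι → A) (n : ι → ℕ)
    (hw : ∀ i, T ^ n i * w i = 0)
    (hgen : ∀ S : Submodule F A, (∀ a, T * a ∈ S) → (∀ i, w i ∈ S) → S = ⊤) :
    ⊤ ≤ Submodule.span F
      (Set.range fun ij : Σ i, Fin (n i) => T ^ (n ij.1 - 1 - (ij.2 : ℕ)) * w ij.1) := by
  set W := Submodule.span F
    (Set.range fun ij : Σ i, Fin (n i) => T ^ (n ij.1 - 1 - (ij.2 : ℕ)) * w ij.1) with hW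
  have hstring (i : ι) (j : ℕ) : T ^ j * w i ∈ W := by
    by_cases hj : j < n i
    · refine Submodule.subset_span ⟨⟨i, ⟨n i - 1 - j, by omega⟩⟩, ?_⟩
      dsimp only
      congr 2
      omega
    · rw [show j = (j - n i) + n i by omega, pow_add, mul_assoc, hw, mul_zero]
      exact W.zero_mem
  have hTW (a : A) (ha : a ∈ W) : T * a ∈ W := by
    induction ha using Submodule.span_induction with
    | mem a h =>
      obtain ⟨ij, rfl⟩ := h
      dsimp only
      rw [← mul_assoc, ← pow_succ']
      exact hstring _ _
    | zero => simp
    | add a b _ _ h1 h2 => rw [mul_add]; exact W.add_mem h1 h2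
    | smul c a _ h => rw [mul_smul_comm]; exact W.smul_mem c h
  have hstep (a : A) : ∃ b, a - T * b ∈ W := by
    have := hgen (W ⊔ LinearMap.range (LinearMap.mulLeft F T))
      (fun a => Submodule.mem_sup_right ⟨a, rfl⟩)
      (fun i => Submodule.mem_sup_left (by simpa using hstring i 0))
    obtain ⟨u, hu, _, ⟨b, rfl⟩, hab⟩ := Submodule.mem_sup.1 (this ▸ Submodule.mem_top : a ∈ _)
    refine ⟨b, ?_⟩
    rw [← hab]
    simpa using hu
  have hpow (m : ℕ) (a : A) : ∃ b, a - T ^ m * b ∈ W := by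
    induction m generalizing a with
    | zero => exact ⟨a, by simp⟩
    | succ m ih =>
      obtain ⟨b, hb⟩ := hstep a
      obtain ⟨c, hc⟩ := ih b
      refine ⟨c, ?_⟩
      have := W.add_mem hb (hTW _ hc)
      convert this using 1
      ring
  obtain ⟨m, hm⟩ := hT
  intro a _
  obtain ⟨b, hb⟩ := hpow m a
  simpa [hm] using hb

/-- On a string `T ^ (n - 1) w, …, T w, w` with `T ^ n w = 0`, multiplication by `1 + T` acts by
the matrix `J_n`. -/
theorem sum_unipotentBlock_smul {n : ℕ} {T w : A} (h : T ^ n * w = 0) (j : Fin n) :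
    ∑ i : Fin n, unipotentBlock F n i j • (T ^ (n - 1 - (i : ℕ)) * w) =
      (1 + T) * (T ^ (n - 1 - (j : ℕ)) * w) := by
  have hsplit (i : Fin n) : unipotentBlock F n i j • (T ^ (n - 1 - (i : ℕ)) * w) =
      (if i = j then T ^ (n - 1 - (i : ℕ)) * w else 0) +
        if (i : ℕ) + 1 = j then T ^ (n - 1 - (i : ℕ)) * w else 0 := by
    rw [unipotentBlock, Matrix.of_apply]
    by_cases h1 : i = j
    · subst h1; simp
    · have h1' : ¬ (j : ℕ) = i := fun h => h1 (Fin.ext h.symm)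
      by_cases h2 : (i : ℕ) + 1 = j
      · simp [h1, h2]
      · have h2' : ¬ (j : ℕ) = i + 1 := fun h => h2 h.symm
        simp [h1, h2, h1', h2']
  simp only [hsplit]
  rw [Finset.sum_add_distrib, Finset.sum_ite_eq' Finset.univ j, add_mul, one_mul,
    if_pos (Finset.mem_univ _)]
  congr 1
  rw [← mul_assoc, ← pow_succ']
  by_cases hj : (j : ℕ) = 0
  · rw [Finset.sum_eq_zero fun i _ => if_neg (by omega), hj,
      show n - 1 - 0 + 1 = n by omega, h]
  · rw [Finset.sum_eq_single ⟨(j : ℕ) - 1, by omega⟩]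
    · rw [if_pos (by simp; omega)]
      congr 2
      simp only
      omega
    · intro i _ hi
      exact if_neg fun h => hi (Fin.ext (by simp; omega))
    · simp

end Strings

/-! ### Marked indices and existence of the Jordan partition -/

section MarkedIndices

open Classical in
/-- The greatest marked index `k ≤ i` (for `P 0`). -/
noncomputable def prevMarked (P : ℕ → Prop) (i : ℕ) : ℕ := Nat.findGreatest P i

/-- The distance from `r` to the least marked index `k > i`, for `i < r` (and `P r`). It is the
greatest marked index up to the mirror image of `i` after the reflection `k ↦ r - k`. -/
noncomputable def nextMarkedGap (P : ℕ → Prop) (r i : ℕ) : ℕ :=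
  prevMarked (fun k => P (r - k)) (r - 1 - i)

/-- The partition of `r * s` with the parts `s + r - k - k'`, each repeated `k' - k` times, where
`k < k'` runs through the pairs of consecutive marked indices in `0, …, r`. -/
noncomputable def markedPartition (P : ℕ → Prop) (r s : ℕ) : List ℕ :=
  (List.range r).map fun i => s + nextMarkedGap P r i - prevMarked P i

variable {P Q : ℕ → Prop} {r i j k l : ℕ}

open Classical in
theorem prevMarked_le : prevMarked P i ≤ i := Nat.findGreatest_le i

open Classical in
theorem prevMarked_spec (h0 : P 0) : P (prevMarked P i) :=
  Nat.findGreatest_spec (P := P) (Nat.zero_le i) h0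

open Classical in
theorem not_of_prevMarked_lt (h : prevMarked P i < l) (hl : l ≤ i) : ¬ P l :=
  Nat.findGreatest_is_greatest h hl

open Classical in
theorem prevMarked_congr (h : ∀ k ≤ i, P k ↔ Q k) : prevMarked P i = prevMarked Q i := by
  unfold prevMarked
  induction i with
  | zero => rfl
  | succ i ih =>
    rw [Nat.findGreatest_succ, Nat.findGreatest_succ, ih fun k hk => h k (by omega)]
    exact if_congr (h (i + 1) le_rfl) rfl rfl

theorem nextMarkedGap_congr (h : ∀ k ≤ r, P k ↔ Q k) :
    nextMarkedGap P r i = nextMarkedGap Q r i :=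
  prevMarked_congr fun _ _ => h _ (Nat.sub_le _ _)

theorem markedPartition_congr {s : ℕ} (h : ∀ k ≤ r, P k ↔ Q k) :
    markedPartition P r s = markedPartition Q r s := by
  refine List.map_congr_left fun i hi => ?_
  have := List.mem_range.1 hi
  rw [nextMarkedGap_congr h, prevMarked_congr fun k hk => h k (by omega)]

theorem nextMarkedGap_le : nextMarkedGap P r i ≤ r - 1 - i := prevMarked_le

theorem not_of_lt_of_lt_nextMarked (hl : i < l) (h : l < r - nextMarkedGap P r i) : ¬ P l := by
  have := not_of_prevMarked_lt (P := fun k => P (r - k)) (i := r - 1 - i) (l := r - l)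
    (by change nextMarkedGap P r i < r - l; omega) (by omega)
  rwa [Nat.sub_sub_self (by omega)] at this

open Classical in
theorem prevMarked_mono (hij : i ≤ j) : prevMarked P i ≤ prevMarked P j :=
  Nat.findGreatest_mono_right _ hij

theorem nextMarkedGap_anti (hij : i ≤ j) : nextMarkedGap P r j ≤ nextMarkedGap P r i :=
  prevMarked_mono (by omega)

open Classical in
theorem lt_prevMarked_iff (h0 : P 0) : j < prevMarked P i ↔ ∃ l, P l ∧ j < l ∧ l ≤ i := by
  refine ⟨fun h => ⟨_, prevMarked_spec h0, h, prevMarked_le⟩, ?_⟩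
  rintro ⟨l, hl, hjl, hli⟩
  exact hjl.trans_le (Nat.le_findGreatest hli hl)

theorem lt_nextMarkedGap_iff (hr : P r) (hi : i < r) (hj : j < r) :
    r - 1 - j < nextMarkedGap P r i ↔ ∃ l, P l ∧ i < l ∧ l ≤ j := by
  rw [nextMarkedGap, lt_prevMarked_iff (by simpa using hr)]
  constructor
  · rintro ⟨l, hl, h1, h2⟩
    exact ⟨r - l, hl, by omega, by omega⟩
  · rintro ⟨l, hl, h1, h2⟩
    exact ⟨r - l, by rwa [Nat.sub_sub_self (by omega)], by omega, by omega⟩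

/-- Both sums count the pairs `(i, j)` that are separated by a marked index. -/
theorem sum_nextMarkedGap_eq_sum_prevMarked (h0 : P 0) (hr : P r) :
    ∑ i ∈ Finset.range r, nextMarkedGap P r i = ∑ i ∈ Finset.range r, prevMarked P i := by
  classical
  have hprev (i : ℕ) (hi : i ∈ Finset.range r) : prevMarked P i =
      ∑ j ∈ Finset.range r, if ∃ l, P l ∧ j < l ∧ l ≤ i then 1 else 0 := by
    have hi' := Finset.mem_range.1 hi
    have hle : prevMarked P i ≤ i := prevMarked_le
    simp only [← lt_prevMarked_iff h0]
    rw [← Finset.sum_filter, ← Finset.card_eq_sum_ones]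
    conv_lhs => rw [← Finset.card_range (prevMarked P i)]
    congr 1
    ext j
    simp only [Finset.mem_range, Finset.mem_filter]
    omega
  have hnext (i : ℕ) (hi : i ∈ Finset.range r) : nextMarkedGap P r i =
      ∑ j ∈ Finset.range r, if ∃ l, P l ∧ i < l ∧ l ≤ j then 1 else 0 := by
    have hi' := Finset.mem_range.1 hi
    have hle : nextMarkedGap P r i ≤ r - 1 - i := nextMarkedGap_le
    have hcount : nextMarkedGap P r i =
        ∑ j ∈ Finset.range r, if r - 1 - j < nextMarkedGap P r i then 1 else 0 := by
      rw [Finset.sum_range_reflect (fun j => if j < nextMarkedGap P r i then 1 else 0) r,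
        ← Finset.sum_filter, ← Finset.card_eq_sum_ones]
      conv_lhs => rw [← Finset.card_range (nextMarkedGap P r i)]
      congr 1
      ext j
      simp only [Finset.mem_range, Finset.mem_filter]
      omega
    refine hcount.trans (Finset.sum_congr rfl fun j hj => ?_)
    simp only [lt_nextMarkedGap_iff hr hi' (Finset.mem_range.1 hj)]
  rw [Finset.sum_congr rfl hprev, Finset.sum_congr rfl hnext, Finset.sum_comm]

theorem length_markedPartition (P : ℕ → Prop) (r s : ℕ) : (markedPartition P r s).length = r := by
  simp [markedPartition]

theorem sum_markedPartition {s : ℕ} (hrs : r ≤ s) (h0 : P 0) (hr : P r) :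
    (markedPartition P r s).sum = r * s := by
  have hsum : (markedPartition P r s).sum =
      ∑ i ∈ Finset.range r, (s + nextMarkedGap P r i - prevMarked P i) := rfl
  have hle : ∀ i ∈ Finset.range r, prevMarked P i ≤ s + nextMarkedGap P r i := fun i hi => by
    have h1 := Finset.mem_range.1 hi
    have h2 : prevMarked P i ≤ i := prevMarked_le
    omega
  rw [hsum, Finset.sum_tsub_distrib _ hle, Finset.sum_add_distrib,
    sum_nextMarkedGap_eq_sum_prevMarked h0 hr]
  simp

theorem pairwise_markedPartition (P : ℕ → Prop) (r s : ℕ) :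
    (markedPartition P r s).Pairwise (· ≥ ·) := by
  refine List.Pairwise.map _ ?_ (List.pairwise_lt_range (n := r))
  intro i j hij
  have h1 := prevMarked_mono (P := P) hij.le
  have h2 := nextMarkedGap_anti (P := P) (r := r) hij.le
  omega

theorem pos_of_mem_markedPartition {s a : ℕ} (hrs : r ≤ s) (ha : a ∈ markedPartition P r s) :
    0 < a := by
  obtain ⟨i, hi, rfl⟩ := List.mem_map.1 ha
  have h1 := List.mem_range.1 hi
  have h2 : prevMarked P i ≤ i := prevMarked_le
  omega

end MarkedIndices

section Existence

open Polynomial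

universe u

variable {F : Type u} [Field F] {r s : ℕ}

/-- The algebra `F[x] / (x ^ r) ⊗ F[y] / (y ^ s)` with its monomial basis, in the order in which
the nilpotent parts of `J_r` and `J_s` act by multiplication by `x` and `y`. -/
theorem exists_truncated_algebra (F : Type u) [Field F] (r s : ℕ) :
    ∃ (A : Type u) (_ : CommRing A) (_ : Algebra F A) (x y : A)
      (b : Module.Basis (Fin r × Fin s) F A), x ^ r = 0 ∧ y ^ s = 0 ∧
        ∀ i j, b (i, j) = x ^ (r - 1 - (i : ℕ)) * y ^ (s - 1 - (j : ℕ)) := by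
  have hbasis (n : ℕ) : ∃ b : Module.Basis (Fin n) F (AdjoinRoot (X ^ n : F[X])),
      ∀ i, b i = AdjoinRoot.root (X ^ n : F[X]) ^ (n - 1 - (i : ℕ)) := by
    have hm : (X ^ n : F[X]).Monic := monic_X_pow n
    have hdim : (AdjoinRoot.powerBasis' hm).dim = n := by
      rw [AdjoinRoot.powerBasis'_dim, natDegree_X_pow]
    refine ⟨((AdjoinRoot.powerBasis' hm).basis.reindex (finCongr hdim)).reindex Fin.revPerm,
      fun i => ?_⟩
    rw [Module.Basis.reindex_apply, Module.Basis.reindex_apply, PowerBasis.basis_eq_pow,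
      AdjoinRoot.powerBasis'_gen]
    congr 1
    simp [Fin.val_rev]
    omega
  have hroot (n : ℕ) : AdjoinRoot.root (X ^ n : F[X]) ^ n = 0 := by
    rw [← AdjoinRoot.mk_X, ← map_pow, AdjoinRoot.mk_self]
  obtain ⟨b₁, hb₁⟩ := hbasis r
  obtain ⟨b₂, hb₂⟩ := hbasis s
  refine ⟨TensorProduct F (AdjoinRoot (X ^ r : F[X])) (AdjoinRoot (X ^ s : F[X])), inferInstance,
    inferInstance, AdjoinRoot.root _ ⊗ₜ[F] 1, 1 ⊗ₜ[F] AdjoinRoot.root _, b₁.tensorProduct b₂,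
    ?_, ?_, fun i j => ?_⟩
  · rw [Algebra.TensorProduct.tmul_pow, hroot, TensorProduct.zero_tmul]
  · rw [Algebra.TensorProduct.tmul_pow, hroot, TensorProduct.tmul_zero]
  · rw [Module.Basis.tensorProduct_apply, hb₁, hb₂, Algebra.TensorProduct.tmul_pow,
      Algebra.TensorProduct.tmul_pow, Algebra.TensorProduct.tmul_mul_tmul, one_pow, one_pow,
      mul_one, one_mul]

/-- `k` is marked if the Padé approximant of type `(r - k - 1, k - 1)` of `(1 + X) ^ (r + s - 2 k)`
is not degenerate. -/
def Nondegenerate (F : Type*) [Field F] (r s k : ℕ) : Prop :=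
  ¬ DegeneratePade F r (r + s - 2 * k) k

/-- The generators of the Jordan strings: in each degree `i < r` the form of the marked index
`k ≤ i` closest to `i`, times `x ^ (i - k)`. -/
theorem exists_string_generators {A : Type*} [CommRing A] [Algebra F A] (hrs : r ≤ s) {x y : A}
    (hx : x ^ r = 0) (hy : y ^ s = 0) :
    ∃ w : ℕ → A, ∀ i < r,
      (x + y + x * y) ^ (s + nextMarkedGap (Nondegenerate F r s) r i -
        prevMarked (Nondegenerate F r s) i) * w i = 0 ∧
      ∃ c : F, c ≠ 0 ∧ x + y + x * y ∣ w i - c • x ^ i := by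
  -- `x + y + x * y` is a unit times `x + z` where `z = y / (1 + y)`
  obtain ⟨v, hv⟩ := IsNilpotent.isUnit_one_add ⟨s, hy⟩
  set z : A := ↑v⁻¹ * y with hz
  have hT : x + y + x * y = v * (x + z) := by
    rw [hz, mul_add, Units.mul_inv_cancel_left, hv]; ring
  have hzs : z ^ s = 0 := by rw [hz, mul_pow, hy, mul_zero]
  set P := Nondegenerate F r s with hP
  have h0 : P 0 := not_degeneratePade_zero
  have hr : P r := not_degeneratePade_self
  have key (i : ℕ) (hi : i < r) : ∃ w : A,
      (x + y + x * y) ^ (s + nextMarkedGap P r i - prevMarked P i) * w = 0 ∧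
      ∃ c : F, c ≠ 0 ∧ x + y + x * y ∣ w - c • x ^ i := by
    have hki : prevMarked P i ≤ i := prevMarked_le
    have hgap : nextMarkedGap P r i ≤ r - 1 - i := nextMarkedGap_le
    obtain ⟨f, hf, hf1, β, hβ, hdvd⟩ := exists_generator_of_consecutive (F := F)
      (k := prevMarked P i) (k' := r - nextMarkedGap P r i) (by omega) (by omega) hrs
      (prevMarked_spec h0) (fun l h1 h2 => by
        by_contra hl
        by_cases hli : l ≤ i
        · exact not_of_prevMarked_lt (P := P) h1 hli hl
        · exact not_of_lt_of_lt_nextMarked (P := P) (by omega) h2 hl)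
    refine ⟨x ^ (i - prevMarked P i) *
      MvPolynomial.aeval ![x, z] (f.homogenize (prevMarked P i)), ?_, ?_⟩
    · have := add_pow_mul_aeval_homogenize_eq_zero (by omega) (by omega) hrs hf hβ hdvd hx hzs
      rw [hT, mul_pow, show s + nextMarkedGap P r i - prevMarked P i =
        r + s - prevMarked P i - (r - nextMarkedGap P r i) by omega]
      linear_combination (v : A) ^ (r + s - prevMarked P i - (r - nextMarkedGap P r i)) *
        x ^ (i - prevMarked P i) * this
    · obtain ⟨c, hc, hcd⟩ := exists_aeval_homogenize_sub_dvd hf hf1 x z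
      refine ⟨c, hc, ?_⟩
      rw [hT, Units.mul_left_dvd]
      convert hcd.mul_left (x ^ (i - prevMarked P i)) using 1
      rw [mul_sub, mul_smul_comm, ← pow_add, Nat.sub_add_cancel hki]
  choose! w hw using key
  exact ⟨w, hw⟩

theorem isJordanPartition_markedPartition (hrs : r ≤ s) :
    IsJordanPartition F r s (markedPartition (Nondegenerate F r s) r s) := by
  set P := Nondegenerate F r s with hP
  set L := markedPartition P r s with hL
  refine ⟨pairwise_markedPartition _ _ _, fun a ha => pos_of_mem_markedPartition hrs ha, ?_⟩
  obtain ⟨A, _, _, x, y, b, hx, hy, hb⟩ := exists_truncated_algebra F r s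
  obtain ⟨w, hw⟩ := exists_string_generators (F := F) hrs hx hy
  set T := x + y + x * y with hT
  have hlen : L.length = r := length_markedPartition _ _ _
  have hget (i : Fin L.length) : L.get i = s + nextMarkedGap P r i - prevMarked P i := by
    simp [hL, markedPartition]
  have hnil : IsNilpotent T := by
    refine (Commute.all (x + y) (x * y)).isNilpotent_add
      ((Commute.all x y).isNilpotent_add ⟨r, hx⟩ ⟨s, hy⟩)
      ⟨r, by rw [mul_pow, hx, zero_mul]⟩
  have hTw (i : Fin L.length) : T ^ L.get i * w i = 0 := by
    rw [hget]; exact (hw i (hlen ▸ i.2)).1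
  have hgen (S : Submodule F A) (hTS : ∀ a, T * a ∈ S) (hwS : ∀ i : Fin L.length, w i ∈ S) :
      S = ⊤ := by
    have hpow (i : ℕ) (hi : i < r) : x ^ i ∈ S := by
      obtain ⟨-, c, hc, d, hd⟩ := hw i hi
      have h1 := S.sub_mem (hwS ⟨i, hlen.symm ▸ hi⟩) (hTS d)
      rw [← hd, sub_sub_cancel] at h1
      exact (S.smul_mem_iff hc).1 h1
    rw [eq_top_iff, ← b.span_eq, Submodule.span_le]
    rintro _ ⟨⟨i, j⟩, rfl⟩
    rw [hb]
    exact pow_mul_pow_mem_of_pow_mem hx hTS hpow _ _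
  have hspan := top_le_span_strings (F := F) hnil (fun i : Fin L.length => w i)
    (fun i => L.get i) hTw hgen
  have hcard : Fintype.card (Σ i : Fin L.length, Fin (L.get i)) = Module.finrank F A := by
    rw [Module.finrank_eq_card_basis b, Fintype.card_sigma, Fintype.card_prod]
    simp only [Fintype.card_fin]
    rw [← sum_markedPartition hrs (P := P) not_degeneratePade_zero not_degeneratePade_self]
    exact Fin.sum_univ_getElem L
  let c := basisOfTopLeSpanOfCardEqFinrank _ hspan hcard
  have hc (i : Fin L.length) (j : Fin (L.get i)) :
      c ⟨i, j⟩ = T ^ (L.get i - 1 - (j : ℕ)) * w i := by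
    simp [c]
  have hbM : LinearMap.toMatrix b b (LinearMap.mulLeft F (1 + T)) =
      unipotentBlock F r ⊗ₖ unipotentBlock F s := by
    rw [← LinearMap.toMatrix_toLin b b (unipotentBlock F r ⊗ₖ unipotentBlock F s)]
    congr 1
    refine b.ext fun ⟨i, j⟩ => ?_
    rw [Matrix.toLin_self, LinearMap.mulLeft_apply, Fintype.sum_prod_type]
    have h1 := sum_unipotentBlock_smul (F := F) (T := x) (w := 1) (by simpa using hx) i
    have h2 := sum_unipotentBlock_smul (F := F) (T := y) (w := 1) (by simpa using hy) j
    simp only [mul_one] at h1 h2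
    have h3 : (1 + T) * b (i, j) = ((1 + x) * x ^ (r - 1 - (i : ℕ))) *
        ((1 + y) * y ^ (s - 1 - (j : ℕ))) := by
      rw [hb, hT]; ring
    rw [h3, ← h1, ← h2, Finset.sum_mul_sum]
    refine Finset.sum_congr rfl fun i' _ => Finset.sum_congr rfl fun j' _ => ?_
    rw [hb, Matrix.kroneckerMap_apply, smul_mul_smul_comm]
  have hcM : LinearMap.toMatrix c c (LinearMap.mulLeft F (1 + T)) = unipotentSum F L := by
    rw [← LinearMap.toMatrix_toLin c c (unipotentSum F L)]
    congr 1
    refine c.ext fun ⟨i, j⟩ => ?_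
    rw [Matrix.toLin_self, LinearMap.mulLeft_apply, Fintype.sum_sigma, hc,
      ← sum_unipotentBlock_smul (F := F) (hTw i) j, Finset.sum_eq_single i]
    · refine Finset.sum_congr rfl fun j' _ => ?_
      rw [unipotentSum, Matrix.blockDiagonal'_apply_eq, hc]
    · intro i' _ hi'
      refine Finset.sum_eq_zero fun j' _ => ?_
      rw [unipotentSum, Matrix.blockDiagonal'_apply_ne _ _ _ hi', zero_smul]
    · simp
  refine ⟨b.toMatrix c, c.toMatrix b, b.toMatrix_mul_toMatrix_flip c,
    c.toMatrix_mul_toMatrix_flip b, ?_⟩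
  rw [← hbM, ← hcM, linearMap_toMatrix_mul_basis_toMatrix, basis_toMatrix_mul_linearMap_toMatrix]

end Existence

/-! ### Uniqueness of the Jordan partition -/

section Uniqueness

variable {F : Type*} [Field F] {r s : ℕ}

/-- The `k`-th power of the nilpotent part of `J_{l₁} ⊕ ⋯ ⊕ J_{lₙ}` shifts coordinates by `k`. -/
theorem unipotentSum_sub_one_pow_mulVec (l : List ℕ) (k : ℕ)
    (v : (Σ i : Fin l.length, Fin (l.get i)) → F) (i : Fin l.length) (j : Fin (l.get i)) :
    ((unipotentSum F l - 1) ^ k).mulVec v ⟨i, j⟩ =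
      if h : (j : ℕ) + k < l.get i then v ⟨i, ⟨j + k, h⟩⟩ else 0 := by
  have hone (u : (Σ i : Fin l.length, Fin (l.get i)) → F) (j : Fin (l.get i)) :
      (unipotentSum F l - 1).mulVec u ⟨i, j⟩ =
        if h : (j : ℕ) + 1 < l.get i then u ⟨i, ⟨j + 1, h⟩⟩ else 0 := by
    rw [Matrix.sub_mulVec, Matrix.one_mulVec, Pi.sub_apply, sub_eq_iff_eq_add', Matrix.mulVec,
      dotProduct, Fintype.sum_sigma, Finset.sum_eq_single i]
    · have hterm (j' : Fin (l.get i)) : unipotentSum F l ⟨i, j⟩ ⟨i, j'⟩ * u ⟨i, j'⟩ =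
          (if j' = j then u ⟨i, j'⟩ else 0) +
            if (j' : ℕ) = j + 1 then u ⟨i, j'⟩ else 0 := by
        rw [unipotentSum, Matrix.blockDiagonal'_apply_eq, unipotentBlock, Matrix.of_apply]
        by_cases h1 : j' = j
        · subst h1; simp
        · have h1' : ¬ (j' : ℕ) = j := fun h => h1 (Fin.ext h)
          by_cases h2 : (j' : ℕ) = j + 1 <;> simp [h1, h2, h1']
      simp only [hterm]
      rw [Finset.sum_add_distrib, Finset.sum_ite_eq' Finset.univ j, if_pos (Finset.mem_univ _)]
      congr 1
      split_ifs with h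
      · rw [Finset.sum_eq_single ⟨j + 1, h⟩]
        · simp
        · intro j' _ hj'
          exact if_neg fun h' => hj' (Fin.ext h')
        · simp
      · exact Finset.sum_eq_zero fun j' _ => if_neg (by omega)
    · intro i' _ hi'
      refine Finset.sum_eq_zero fun j' _ => ?_
      rw [unipotentSum, Matrix.blockDiagonal'_apply_ne _ _ _ hi'.symm, zero_mul]
    · simp
  induction k generalizing v with
  | zero => simp
  | succ k ih =>
    rw [pow_succ, ← Matrix.mulVec_mulVec, ih]
    by_cases h : (j : ℕ) + k < l.get i
    · rw [dif_pos h, hone]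
      rfl
    · rw [dif_neg h, dif_neg (by omega)]

theorem finrank_ker_unipotentSum_sub_one_pow (l : List ℕ) (k : ℕ) :
    Module.finrank F (LinearMap.ker ((unipotentSum F l - 1) ^ k).mulVecLin) =
      (l.map fun a => min a k).sum := by
  classical
  let S : Set (Σ i : Fin l.length, Fin (l.get i)) := {ij | (ij.2 : ℕ) < k}
  have hmem (v : (Σ i : Fin l.length, Fin (l.get i)) → F) :
      v ∈ LinearMap.ker ((unipotentSum F l - 1) ^ k).mulVecLin ↔ ∀ ij, ij ∉ S → v ij = 0 := by
    rw [LinearMap.mem_ker, Matrix.mulVecLin_apply]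
    constructor
    · rintro h ⟨i, j⟩ hij
      have hkj : k ≤ j := not_lt.1 hij
      have := congrFun h ⟨i, ⟨j - k, by omega⟩⟩
      have hlt : (j : ℕ) - k + k < l.get i := by omega
      rw [unipotentSum_sub_one_pow_mulVec, dif_pos hlt] at this
      simpa only [Nat.sub_add_cancel hkj, Fin.eta, Pi.zero_apply] using this
    · intro h
      ext ⟨i, j⟩
      rw [unipotentSum_sub_one_pow_mulVec]
      split_ifs
      · exact h _ (by simp [S])
      · rfl
  let e : LinearMap.ker ((unipotentSum F l - 1) ^ k).mulVecLin ≃ₗ[F] (S → F) :=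
    { toFun := fun v ij => v.1 ij
      map_add' := fun _ _ => rfl
      map_smul' := fun _ _ => rfl
      invFun := fun u => ⟨fun ij => if h : ij ∈ S then u ⟨ij, h⟩ else 0,
        (hmem _).2 fun ij h => dif_neg h⟩
      left_inv := fun v => by
        ext ij
        by_cases h : ij ∈ S
        · simp [h]
        · simp [h, (hmem _).1 v.2 ij h]
      right_inv := fun u => by
        ext ij
        simp }
  rw [e.finrank_eq, Module.finrank_fintype_fun_eq_card, Fintype.card_subtype,
    Finset.card_filter, Fintype.sum_sigma]
  have hblock (n : ℕ) : ∑ j : Fin n, (if (j : ℕ) < k then 1 else 0) = min n k := by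
    rw [Fin.sum_univ_eq_sum_range (fun j => if j < k then 1 else 0), ← Finset.sum_filter,
      ← Finset.card_eq_sum_ones]
    conv_rhs => rw [← Finset.card_range (min n k)]
    congr 1
    ext j
    simp
  have hS (i : Fin l.length) (j : Fin (l.get i)) :
      ((⟨i, j⟩ : Σ i : Fin l.length, Fin (l.get i)) ∈ S) ↔ (j : ℕ) < k := Iff.rfl
  simp only [hS, hblock]
  exact Fin.sum_univ_fun_getElem l fun a => min a k

/-- A partition is determined by the sums of the `min a k` over its parts `a`: their second
differences are the multiplicities of the parts. -/
theorem eq_of_sum_map_min_eq {l l' : List ℕ} (h : l.Pairwise (· ≥ ·)) (h' : l'.Pairwise (· ≥ ·))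
    (hpos : ∀ a ∈ l, 0 < a) (hpos' : ∀ a ∈ l', 0 < a)
    (hsum : ∀ k, (l.map fun a => min a k).sum = (l'.map fun a => min a k).sum) : l = l' := by
  have hcount (m : List ℕ) (k : ℕ) : 2 * (m.map fun a => min a (k + 1)).sum =
      (m.map fun a => min a k).sum + (m.map fun a => min a (k + 2)).sum + m.count (k + 1) := by
    induction m with
    | nil => rfl
    | cons a m ih =>
      rw [List.count_cons]
      simp only [List.map_cons, List.sum_cons, beq_iff_eq]
      split_ifs <;> omega
  refine List.Perm.eq_of_pairwise (fun a b _ _ h1 h2 => le_antisymm h2 h1) h h' ?_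
  refine List.perm_iff_count.2 fun a => ?_
  rcases a with _ | k
  · rw [List.count_eq_zero_of_not_mem fun h0 => (hpos 0 h0).false,
      List.count_eq_zero_of_not_mem fun h0 => (hpos' 0 h0).false]
  · have h1 := hcount l k
    have h2 := hcount l' k
    rw [hsum, hsum, hsum] at h1
    omega

/-- The dimensions of the kernels of the powers of `J_r ⊗ J_s - 1` determine the partition. -/
theorem IsJordanPartition.eq {l l' : List ℕ} (h : IsJordanPartition F r s l)
    (h' : IsJordanPartition F r s l') : l = l' := by
  classical
  have key {m : List ℕ} (hm : IsJordanPartition F r s m) (k : ℕ) :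
      (m.map fun a => min a k).sum = Module.finrank F (LinearMap.ker
        ((unipotentBlock F r ⊗ₖ unipotentBlock F s - 1) ^ k).mulVecLin) := by
    obtain ⟨-, -, P, Q, hPQ, hQP, hP⟩ := hm
    have hone : (unipotentBlock F r ⊗ₖ unipotentBlock F s - 1) * P =
        P * (unipotentSum F m - 1) := by
      rw [Matrix.sub_mul, Matrix.mul_sub, hP, Matrix.one_mul, Matrix.mul_one]
    have hpow (k : ℕ) : (unipotentBlock F r ⊗ₖ unipotentBlock F s - 1) ^ k * P =
        P * (unipotentSum F m - 1) ^ k := by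
      induction k with
      | zero => simp
      | succ k ih => rw [pow_succ, Matrix.mul_assoc, hone, ← Matrix.mul_assoc, ih,
          Matrix.mul_assoc, ← pow_succ]
    have hpow' : (unipotentSum F m - 1) ^ k * Q =
        Q * (unipotentBlock F r ⊗ₖ unipotentBlock F s - 1) ^ k := by
      calc _ = Q * (P * (unipotentSum F m - 1) ^ k) * Q := by
            rw [← Matrix.mul_assoc, hQP, Matrix.one_mul]
        _ = _ := by rw [← hpow, Matrix.mul_assoc, Matrix.mul_assoc, hPQ, Matrix.mul_one]
    rw [← finrank_ker_unipotentSum_sub_one_pow (F := F)]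
    refine LinearEquiv.finrank_eq
      { toFun := fun v => ⟨P.mulVec v.1, ?_⟩
        map_add' := fun u v => Subtype.ext (Matrix.mulVec_add _ _ _)
        map_smul' := fun c v => Subtype.ext (Matrix.mulVec_smul _ _ _)
        invFun := fun v => ⟨Q.mulVec v.1, ?_⟩
        left_inv := fun v => Subtype.ext (by simp [hQP])
        right_inv := fun v => Subtype.ext (by simp [hPQ]) }
    · have hv := LinearMap.mem_ker.1 v.2
      rw [Matrix.mulVecLin_apply] at hv
      rw [LinearMap.mem_ker, Matrix.mulVecLin_apply, Matrix.mulVec_mulVec, hpow,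
        ← Matrix.mulVec_mulVec, hv, Matrix.mulVec_zero]
    · have hv := LinearMap.mem_ker.1 v.2
      rw [Matrix.mulVecLin_apply] at hv
      rw [LinearMap.mem_ker, Matrix.mulVecLin_apply, Matrix.mulVec_mulVec, hpow',
        ← Matrix.mulVec_mulVec, hv, Matrix.mulVec_zero]
  exact eq_of_sum_map_min_eq h.1 h'.1 h.2.1 h'.2.1 fun k => (key h k).trans (key h' k).symm

theorem isJordanPartition_iff (hrs : r ≤ s) (l : List ℕ) :
    IsJordanPartition F r s l ↔ l = markedPartition (Nondegenerate F r s) r s :=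
  ⟨fun h => h.eq (isJordanPartition_markedPartition hrs),
    fun h => h ▸ isJordanPartition_markedPartition hrs⟩

theorem jordanPartition_eq {p : ℕ} [Fact p.Prime] (hrs : r ≤ s) :
    jordanPartition r s p = markedPartition (Nondegenerate (ZMod p) r s) r s := by
  have h : ∃ l, IsJordanPartition (ZMod p) r s l := ⟨_, isJordanPartition_markedPartition hrs⟩
  rw [jordanPartition, dif_pos h]
  exact (isJordanPartition_iff hrs _).1 h.choose_spec

theorem jordanPartition_eq_of_charP (F : Type*) [Field F] {p : ℕ} [Fact p.Prime] [CharP F p]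
    (hrs : r ≤ s) : jordanPartition r s p = markedPartition (Nondegenerate F r s) r s := by
  rw [jordanPartition_eq hrs]
  exact markedPartition_congr fun k hk => not_congr (degeneratePade_iff_zmod hk).symm

/-- The differences `λᵢ - s` for the partition of the marked indices. -/
noncomputable def markedDeviation (P : ℕ → Prop) (r : ℕ) : List ℤ :=
  (List.range r).map fun i => (nextMarkedGap P r i : ℤ) - prevMarked P i

/-- In `deviation` the cast to `ℤ` applies to the list as a whole, before the subtraction. -/
theorem deviation_eq_map (r s p : ℕ) :
    deviation r s p = (jordanPartition r s p).map fun a : ℕ => (a : ℤ) - (s : ℤ) := by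
  simp [deviation, ← List.map_eq_flatMap]

theorem standardDeviation_eq_map (r : ℕ) :
    standardDeviation r = (List.range r).map fun i : ℕ => (r : ℤ) - 1 - 2 * (i : ℤ) := by
  simp [standardDeviation, ← List.map_eq_flatMap]

theorem deviation_eq {p : ℕ} [Fact p.Prime] (hrs : r ≤ s) :
    deviation r s p = markedDeviation (Nondegenerate (ZMod p) r s) r := by
  rw [deviation_eq_map, jordanPartition_eq hrs, markedPartition, List.map_map, markedDeviation]
  refine List.map_congr_left fun i hi => ?_
  have h1 := List.mem_range.1 hi
  have h2 : prevMarked (Nondegenerate (ZMod p) r s) i ≤ i := prevMarked_le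
  simp only [Function.comp_apply]
  omega

theorem markedDeviation_congr {P Q : ℕ → Prop} (h : ∀ k ≤ r, P k ↔ Q k) :
    markedDeviation P r = markedDeviation Q r := by
  refine List.map_congr_left fun i hi => ?_
  have := List.mem_range.1 hi
  rw [nextMarkedGap_congr h, prevMarked_congr fun k hk => h k (by omega)]

theorem markedDeviation_reflect {P Q : ℕ → Prop} (h : ∀ k ≤ r, P k ↔ Q (r - k)) :
    markedDeviation P r = negReverse (markedDeviation Q r) := by
  refine List.ext_getElem (by simp [markedDeviation, negReverse]) fun i h1 h2 => ?_
  have hi : i < r := by simpa [markedDeviation] using h1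
  have hP : prevMarked P i = nextMarkedGap Q r (r - 1 - i) := by
    rw [nextMarkedGap, show r - 1 - (r - 1 - i) = i by omega]
    exact prevMarked_congr fun k hk => h k (by omega)
  have hN : nextMarkedGap P r i = prevMarked Q (r - 1 - i) :=
    prevMarked_congr fun k hk => by rw [h (r - k) (Nat.sub_le _ _), Nat.sub_sub_self (by omega)]
  simp [markedDeviation, negReverse, hP, hN]

theorem markedDeviation_of_forall {P : ℕ → Prop} (h : ∀ k ≤ r, P k) :
    markedDeviation P r = standardDeviation r := by
  classical
  rw [standardDeviation_eq_map]
  refine List.map_congr_left fun i hi => ?_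
  have hi' := List.mem_range.1 hi
  have h1 : prevMarked P i = i := le_antisymm prevMarked_le (Nat.le_findGreatest le_rfl (h i hi'.le))
  have h2 : nextMarkedGap P r i = r - 1 - i :=
    le_antisymm prevMarked_le (Nat.le_findGreatest le_rfl (h _ (Nat.sub_le _ _)))
  rw [h1, h2]
  omega

end Uniqueness

/-! ### Rules for the deviation vector -/

section Rules

variable {r s s' p p' k k₀ : ℕ}

theorem le_leastPower (hp : p.Prime) : r ≤ leastPower r p := Nat.le_pow_clog hp.one_lt r

theorem deviation_eq_standardDeviation (hrs : r ≤ s) (hp : p.Prime)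
    (h : StandardCongruence r s p) : deviation r s p = standardDeviation r := by
  have : Fact p.Prime := ⟨hp⟩
  rw [deviation_eq hrs]
  refine markedDeviation_of_forall fun k hk => ?_
  rcases Nat.eq_zero_or_pos k with rfl | hk0
  · exact not_degeneratePade_zero
  refine not_degeneratePade_of_descFactorial_ne_zero hk fun i hi h0 => ?_
  -- a factor that vanishes in `ZMod p` is a number divisible by `p` at distance `≤ r - 2` from `s`
  rw [ZMod.natCast_eq_zero_iff, Nat.descFactorial_eq_prod_range,
    hp.prime.dvd_finsetProd_iff] at h0
  obtain ⟨j, hj, t, ht⟩ := h0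
  have hj' := Finset.mem_range.1 hj
  rcases le_total s (p * t) with hst | hst
  · refine (h (p * t - s) (by omega)).2 ?_
    refine (Int.modEq_iff_dvd.2 ⟨t, ?_⟩).symm
    rw [Nat.cast_sub hst]
    push_cast
    ring
  · refine (h (s - p * t) (by omega)).1 ?_
    refine (Int.modEq_iff_dvd.2 ⟨t, ?_⟩).symm
    rw [Nat.cast_sub hst]
    push_cast
    ring

theorem deviation_eq_of_modEq {m : ℕ} (hrs : r ≤ s) (hrs' : r ≤ s') (hp : p.Prime)
    (hm : r ≤ p ^ m) (h : (s : ℤ) ≡ s' [ZMOD (p ^ m : ℕ)]) :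
    deviation r s p = deviation r s' p := by
  have : Fact p.Prime := ⟨hp⟩
  rw [deviation_eq hrs, deviation_eq hrs']
  refine markedDeviation_congr fun k hk => not_congr (degeneratePade_congr hm ?_)
  rw [← Int.natCast_modEq_iff, Nat.cast_sub (by omega), Nat.cast_sub (by omega)]
  push_cast at h ⊢
  exact (h.add_left _).sub_right _

theorem deviation_eq_negReverse_of_modEq {m : ℕ} (hrs : r ≤ s) (hrs' : r ≤ s') (hp : p.Prime)
    (hm : r ≤ p ^ m) (h : (s : ℤ) ≡ -s' [ZMOD (p ^ m : ℕ)]) :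
    deviation r s p = negReverse (deviation r s' p) := by
  have : Fact p.Prime := ⟨hp⟩
  rw [deviation_eq hrs, deviation_eq hrs']
  refine markedDeviation_reflect fun k hk => not_congr (degeneratePade_symm hm hk ?_)
  have h1 := h.symm.dvd
  rw [sub_neg_eq_add] at h1
  rw [show r + s - 2 * k + (r + s' - 2 * (r - k)) = s + s' by omega]
  exact_mod_cast h1

/-- From this prime on, `ε(r, s, p)` depends only on the residue `k ≤ r - 2` of `s`: it exceeds the
absolute values of the determinants that decide which approximants are degenerate. -/
def primeThreshold (r : ℕ) : ℕ := (r * 4 ^ r) ^ r + 2 * r + 2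

theorem abs_det_padeMatrix_lt {n : ℕ} (hk : k ≤ r) (hn : n ≤ 2 * r) :
    |(padeMatrix r n k).det| < primeThreshold r := by
  have h1 : |(padeMatrix r n k).det| ≤ k.factorial • ((4 ^ r : ℕ) : ℤ) ^ k := by
    have := Matrix.det_le (A := padeMatrix r n k) (abv := AbsoluteValue.abs)
      (x := ((4 ^ r : ℕ) : ℤ)) fun i j => ?_
    · simpa using this
    · rw [padeMatrix, Matrix.of_apply, AbsoluteValue.abs_apply]
      split_ifs
      · rw [Nat.abs_cast, Nat.cast_le, show 4 = 2 ^ 2 by norm_num, ← pow_mul]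
        exact (Nat.choose_le_two_pow _ _).trans (Nat.pow_le_pow_right two_pos hn)
      · simp
  have h2 : k.factorial * (4 ^ r) ^ k ≤ (r * 4 ^ r) ^ r := by
    rcases Nat.eq_zero_or_pos r with rfl | hr
    · simp [Nat.le_zero.1 hk]
    · calc k.factorial * (4 ^ r) ^ k ≤ r ^ k * (4 ^ r) ^ k :=
            Nat.mul_le_mul_right _ ((Nat.factorial_le_pow k).trans (Nat.pow_le_pow_left hk k))
        _ = (r * 4 ^ r) ^ k := (mul_pow _ _ _).symm
        _ ≤ (r * 4 ^ r) ^ r := Nat.pow_le_pow_right (by positivity) hk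
  rw [nsmul_eq_mul] at h1
  have h3 : ((k.factorial * (4 ^ r) ^ k : ℕ) : ℤ) ≤ ((r * 4 ^ r) ^ r : ℕ) := by exact_mod_cast h2
  have h4 : (((r * 4 ^ r) ^ r : ℕ) : ℤ) < primeThreshold r := by
    rw [Nat.cast_lt, primeThreshold]; omega
  push_cast at h1 h3 h4 ⊢
  linarith

theorem degeneratePade_iff_det_eq_zero [Fact p.Prime] {n : ℕ} (hk : k ≤ r) (hn : n ≤ 2 * r)
    (hp : primeThreshold r ≤ p) :
    DegeneratePade (ZMod p) r n k ↔ (padeMatrix r n k).det = 0 := by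
  rw [degeneratePade_iff_det hk, CharP.intCast_eq_zero_iff (ZMod p) p]
  refine ⟨fun h => Int.eq_zero_of_abs_lt_dvd h ?_, fun h => h ▸ dvd_zero _⟩
  exact (abs_det_padeMatrix_lt hk hn).trans_le (by exact_mod_cast hp)

/-- For a large prime `p` and `s ≡ k₀` modulo `p`, the exponent `r + s - 2 k` may be replaced by the
small integer `r + k₀ - 2 k`, or, when this is negative, by its opposite. -/
theorem nondegenerate_iff_of_large [Fact p.Prime] (hrs : r ≤ s) (hp : primeThreshold r ≤ p)
    (hk₀ : k₀ ≤ r) (hs : (s : ℤ) ≡ k₀ [ZMOD p]) (hk : k ≤ r) :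
    Nondegenerate (ZMod p) r s k ↔
      if 2 * k ≤ r + k₀ then (padeMatrix r (r + k₀ - 2 * k) k).det ≠ 0
      else (padeMatrix r (2 * k - (r + k₀)) (r - k)).det ≠ 0 := by
  have hrp : r ≤ p ^ 1 := by
    rw [pow_one]
    refine le_trans ?_ hp
    rw [primeThreshold]
    omega
  split_ifs with h
  · rw [ne_eq, ← degeneratePade_iff_det_eq_zero (p := p) hk (by omega) hp]
    refine not_congr (degeneratePade_congr hrp ?_)
    rw [← Int.natCast_modEq_iff, Nat.cast_sub (by omega), Nat.cast_sub h, pow_one]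
    push_cast
    exact (hs.add_left _).sub_right _
  · rw [ne_eq, ← degeneratePade_iff_det_eq_zero (p := p) (Nat.sub_le _ _) (by omega) hp]
    refine not_congr (degeneratePade_symm hrp hk ?_)
    rw [← Int.natCast_dvd_natCast, pow_one, Nat.cast_add, Nat.cast_sub (by omega),
      Nat.cast_sub (by omega)]
    convert hs.symm.dvd using 1
    push_cast
    ring

theorem deviation_eq_of_large (hrs : r ≤ s) (hrs' : r ≤ s') (hp : p.Prime) (hp' : p'.Prime)
    (hN : primeThreshold r ≤ p) (hN' : primeThreshold r ≤ p') (hk₀ : k₀ ≤ r)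
    (hs : (s : ℤ) ≡ k₀ [ZMOD p]) (hs' : (s' : ℤ) ≡ k₀ [ZMOD p']) :
    deviation r s p = deviation r s' p' := by
  have : Fact p.Prime := ⟨hp⟩
  have : Fact p'.Prime := ⟨hp'⟩
  rw [deviation_eq hrs, deviation_eq hrs']
  refine markedDeviation_congr fun k hk => ?_
  rw [nondegenerate_iff_of_large hrs hN hk₀ hs hk, nondegenerate_iff_of_large hrs' hN' hk₀ hs' hk]

theorem deviation_eq_of_sameResidue (hrs : r ≤ s) (hrs' : r ≤ s') (hp : p.Prime)
    (hp' : p'.Prime) (h : SameResidue r (primeThreshold r) s p s' p') :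
    deviation r s p = deviation r s' p' := by
  rcases h with ⟨rfl, h⟩ | ⟨hN, hN', k, hk, hs, hs'⟩
  · exact deviation_eq_of_modEq hrs hrs' hp (le_leastPower hp) h
  · exact deviation_eq_of_large hrs hrs' hp hp' hN hN' (by omega) hs hs'

theorem deviation_eq_of_oppositeResidue (hrs : r ≤ s) (hrs' : r ≤ s') (hp : p.Prime)
    (hp' : p'.Prime) (h : OppositeResidue r (primeThreshold r) s p s' p') :
    deviation r s p = negReverse (deviation r s' p') := by
  rcases h with ⟨rfl, h⟩ | ⟨hN, hN', k, hk, hs, hs'⟩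
  · exact deviation_eq_negReverse_of_modEq hrs hrs' hp (le_leastPower hp) h
  · have hrp : r ≤ p := by
      refine le_trans ?_ hN
      rw [primeThreshold]
      omega
    -- pass through `k + p`, which is opposite to `s` modulo `p`
    have hmid : ((k + p : ℕ) : ℤ) ≡ k [ZMOD p] := by simp
    rw [deviation_eq_negReverse_of_modEq (m := 1) (s' := k + p) hrs (by omega) hp (by simpa)
      (by rw [pow_one]; exact hs.trans hmid.symm.neg),
      deviation_eq_of_large (by omega) hrs' hp hp' hN hN' (by omega) hmid hs']

end Rules

/-! ### Computability of the table -/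

section PrimitiveRecursion

open Primrec

variable {α : Type*} [Primcodable α]

theorem PrimrecRel.exists_lt_comp {R : α → ℕ → Prop} {f : α → ℕ} (hR : PrimrecRel R)
    (hf : Primrec f) : PrimrecPred fun a => ∃ x < f a, R a x :=
  (PrimrecRel.exists_mem_list (R := fun x a => R a x) (hR.comp snd fst)).comp
    (list_range.comp hf) Primrec.id |>.of_eq fun a => by simp

theorem PrimrecRel.forall_lt_comp {R : α → ℕ → Prop} {f : α → ℕ} (hR : PrimrecRel R)
    (hf : Primrec f) : PrimrecPred fun a => ∀ x < f a, R a x :=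
  (PrimrecRel.forall_mem_list (R := fun x a => R a x) (hR.comp snd fst)).comp
    (list_range.comp hf) Primrec.id |>.of_eq fun a => by simp

theorem Primrec.sum_range {f : α → ℕ → ℕ} {g : α → ℕ} (hf : Primrec₂ f) (hg : Primrec g) :
    Primrec fun a => ∑ j ∈ Finset.range (g a), f a j :=
  (nat_rec' (h := fun a (nb : ℕ × ℕ) => nb.2 + f a nb.1) hg (const 0)
    (nat_add.comp (snd.comp snd) (hf.comp fst (fst.comp snd)))).of_eq fun a => by
      induction g a with
      | zero => rfl
      | succ n ih => rw [Finset.sum_range_succ, ← ih]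

theorem Primrec.nat_pow : Primrec₂ ((· ^ ·) : ℕ → ℕ → ℕ) := Primrec₂.unpaired'.1 Nat.Primrec.pow

theorem Primrec.nat_choose : Primrec₂ Nat.choose := by
  have hfac : Primrec Nat.factorial :=
    (nat_rec' (h := fun (_ : ℕ) (nb : ℕ × ℕ) => (nb.1 + 1) * nb.2) Primrec.id (const 1)
      (nat_mul.comp (succ.comp (fst.comp snd)) (snd.comp snd))).of_eq fun n => by
        induction n with
        | zero => rfl
        | succ n ih => exact congrArg ((n + 1) * ·) ih
  have hdesc : Primrec₂ Nat.descFactorial :=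
    (nat_rec' (f := fun nk : ℕ × ℕ => nk.2) (g := fun _ => 1)
      (h := fun nk (nb : ℕ × ℕ) => (nk.1 - nb.1) * nb.2) snd (const 1)
      (nat_mul.comp (nat_sub.comp (fst.comp fst) (fst.comp snd)) (snd.comp snd))).of_eq
        fun ⟨n, k⟩ => by
          induction k with
          | zero => rfl
          | succ k ih => exact congrArg ((n - k) * ·) ih
  exact (nat_div.comp hdesc (hfac.comp snd)).of_eq fun ⟨n, k⟩ =>
    (Nat.choose_eq_descFactorial_div_factorial n k).symm

theorem Primrec.nat_cast_sub_nat_cast : Primrec₂ fun a b : ℕ => (a : ℤ) - (b : ℤ) := by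
  classical
  -- the code of `n` is `2 * n`, and the code of `-(n + 1)` is `2 * n + 1`
  have h : Primrec fun ab : ℕ × ℕ => if ab.2 ≤ ab.1 then 2 * (ab.1 - ab.2)
      else 2 * (ab.2 - ab.1 - 1) + 1 :=
    Primrec.ite (nat_le.comp snd fst) (nat_mul.comp (const 2) nat_sub)
      (succ.comp (nat_mul.comp (const 2) (nat_sub.comp (nat_sub.comp snd fst) (const 1))))
  refine Primrec.encode_iff.1 (h.of_eq fun ⟨a, b⟩ => ?_)
  dsimp only
  split_ifs with hab
  · obtain ⟨c, rfl⟩ := Nat.exists_eq_add_of_le hab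
    rw [Nat.add_sub_cancel_left, Nat.cast_add, add_sub_cancel_left]
    rfl
  · obtain ⟨c, rfl⟩ := Nat.exists_eq_add_of_lt (not_le.1 hab)
    have : ((a : ℤ) - ((a + c + 1 : ℕ) : ℤ)) = Int.negSucc c := by
      rw [Int.negSucc_eq]; push_cast; ring
    rw [this, show a + c + 1 - a - 1 = c by omega]
    rfl

theorem primrecPred_prime : PrimrecPred Nat.Prime := by
  have h : PrimrecRel fun p m : ℕ => ¬ p % m = 0 ∨ m = 1 :=
    (Primrec.eq.comp nat_mod (const 0)).not.or (Primrec.eq.comp snd (const 1))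
  refine ((nat_le.comp (const 2) Primrec.id).and (h.forall_lt_comp Primrec.id)).of_eq fun p => ?_
  rw [Nat.prime_def_lt]
  simp only [Nat.dvd_iff_mod_eq_zero, id_eq, imp_iff_not_or]

theorem primrec_prevMarked {P : α → ℕ → Prop} {f : α → ℕ} (hP : PrimrecRel P) (hf : Primrec f) :
    Primrec fun a => prevMarked (P a) (f a) := by
  classical
  exact nat_findGreatest hf hP

theorem primrec_markedDeviation {P : α → ℕ → Prop} {f : α → ℕ} (hP : PrimrecRel P)
    (hf : Primrec f) : Primrec fun a => markedDeviation (P a) (f a) := by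
  refine list_map (list_range.comp hf) (Primrec.nat_cast_sub_nat_cast.comp
    (primrec_prevMarked (P := fun (ai : α × ℕ) k => P ai.1 (f ai.1 - k))
      (f := fun ai => f ai.1 - 1 - ai.2) ?_ ?_)
    (primrec_prevMarked (P := fun (ai : α × ℕ) k => P ai.1 k) (f := fun ai => ai.2) ?_ snd))
  · exact hP.comp (fst.comp fst) (nat_sub.comp (hf.comp (fst.comp fst)) snd)
  · exact nat_sub.comp (nat_sub.comp (hf.comp fst) (const 1)) snd
  · exact hP.comp (fst.comp fst) snd

end PrimitiveRecursion

section Algorithm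

open Primrec

variable {p r n k : ℕ}

/-- The existence of a degenerate Padé approximant over `ZMod p` as a bounded search: the digits of
`c` to the base `p` are the coefficients of the polynomial `g`. -/
def DegenerateSearch (p r n k : ℕ) : Prop :=
  ∃ c < p ^ k, (∃ j < k, ¬ c / p ^ j % p = 0) ∧ ∀ i < k, (∑ j ∈ Finset.range k,
    (if j ≤ r - k + i then n.choose (r - k + i - j) else 0) * (c / p ^ j % p)) % p = 0

theorem degenerateSearch_iff [Fact p.Prime] (hk : k ≤ r) :
    DegenerateSearch p r n k ↔ DegeneratePade (ZMod p) r n k := by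
  have hp : 0 < p := (Fact.out : p.Prime).pos
  rw [degeneratePade_iff_exists_coeff hk]
  have hcast (d : ℕ → ℕ) (i : ℕ) : (∑ j ∈ Finset.range k,
      (if j ≤ r - k + i then n.choose (r - k + i - j) else 0) * d j) % p = 0 ↔
      ∑ j ∈ Finset.range k,
        (if j ≤ r - k + i then ((n.choose (r - k + i - j) : ℕ) : ZMod p) else 0) *
          (d j : ZMod p) = 0 := by
    rw [← Nat.dvd_iff_mod_eq_zero, ← ZMod.natCast_eq_zero_iff]
    push_cast
    rfl
  constructor
  · rintro ⟨c, -, ⟨j, hj, hcj⟩, h⟩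
    refine ⟨fun j => ((c / p ^ j % p : ℕ) : ZMod p), ⟨j, hj, ?_⟩, fun i hi => ?_⟩
    · rw [Ne, ZMod.natCast_eq_zero_iff]
      intro hd
      exact hcj (Nat.eq_zero_of_dvd_of_lt hd (Nat.mod_lt _ hp))
    · exact (hcast (fun j => c / p ^ j % p) i).1 (h i hi)
  · rintro ⟨c, ⟨j, hj, hcj⟩, h⟩
    let d : Fin (p ^ k) := finFunctionFinEquiv fun j : Fin k => ⟨(c j).val, ZMod.val_lt _⟩
    have hd (j : ℕ) (hj : j < k) : (d : ℕ) / p ^ j % p = (c j).val := by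
      have := congrFun (finFunctionFinEquiv.symm_apply_apply
        fun j : Fin k => (⟨(c j).val, ZMod.val_lt _⟩ : Fin p)) ⟨j, hj⟩
      exact congrArg Fin.val this
    refine ⟨d, d.2, ⟨j, hj, ?_⟩, fun i hi => ?_⟩
    · rwa [hd j hj, ZMod.val_eq_zero]
    · refine (hcast (fun j => (d : ℕ) / p ^ j % p) i).2 (Eq.trans ?_ (h i hi))
      refine Finset.sum_congr rfl fun j hj => ?_
      rw [hd j (Finset.mem_range.1 hj), ZMod.natCast_zmod_val]

theorem primrecPred_degenerateSearch : PrimrecPred fun a : (ℕ × ℕ) × ℕ × ℕ =>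
    DegenerateSearch a.1.1 a.1.2 a.2.1 a.2.2 := by
  classical
  have hp : Primrec fun a : (ℕ × ℕ) × ℕ × ℕ => a.1.1 := fst.comp fst
  have hr : Primrec fun a : (ℕ × ℕ) × ℕ × ℕ => a.1.2 := snd.comp fst
  have hn : Primrec fun a : (ℕ × ℕ) × ℕ × ℕ => a.2.1 := fst.comp snd
  have hk : Primrec fun a : (ℕ × ℕ) × ℕ × ℕ => a.2.2 := snd.comp snd
  have hdigit : Primrec₂ fun (ac : ((ℕ × ℕ) × ℕ × ℕ) × ℕ) (j : ℕ) =>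
      ac.2 / ac.1.1.1 ^ j % ac.1.1.1 :=
    nat_mod.comp (nat_div.comp (snd.comp fst)
      (Primrec.nat_pow.comp (hp.comp (fst.comp fst)) snd)) (hp.comp (fst.comp fst))
  have hnonzero : PrimrecRel fun (ac : ((ℕ × ℕ) × ℕ × ℕ) × ℕ) (j : ℕ) =>
      ¬ ac.2 / ac.1.1.1 ^ j % ac.1.1.1 = 0 := (Primrec.eq.comp hdigit (const 0)).not
  have hrow : Primrec fun (b : ((((ℕ × ℕ) × ℕ × ℕ) × ℕ) × ℕ) × ℕ) =>
      b.1.1.1.1.2 - b.1.1.1.2.2 + b.1.2 :=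
    nat_add.comp (nat_sub.comp (hr.comp (fst.comp (fst.comp fst)))
      (hk.comp (fst.comp (fst.comp fst)))) (snd.comp fst)
  have hterm : Primrec₂ fun (b : (((ℕ × ℕ) × ℕ × ℕ) × ℕ) × ℕ) (j : ℕ) =>
      (if j ≤ b.1.1.1.2 - b.1.1.2.2 + b.2 then
        b.1.1.2.1.choose (b.1.1.1.2 - b.1.1.2.2 + b.2 - j) else 0) *
        (b.1.2 / b.1.1.1.1 ^ j % b.1.1.1.1) :=
    nat_mul.comp (Primrec.ite (nat_le.comp snd hrow)
      (Primrec.nat_choose.comp (hn.comp (fst.comp (fst.comp fst))) (nat_sub.comp hrow snd))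
      (const 0)) (hdigit.comp (fst.comp fst) snd)
  have hsum : PrimrecRel fun (ac : ((ℕ × ℕ) × ℕ × ℕ) × ℕ) (i : ℕ) =>
      (∑ j ∈ Finset.range ac.1.2.2,
        (if j ≤ ac.1.1.2 - ac.1.2.2 + i then
          ac.1.2.1.choose (ac.1.1.2 - ac.1.2.2 + i - j) else 0) *
          (ac.2 / ac.1.1.1 ^ j % ac.1.1.1)) % ac.1.1.1 = 0 :=
    Primrec.eq.comp (nat_mod.comp (Primrec.sum_range hterm (hk.comp (fst.comp fst)))
      (hp.comp (fst.comp fst))) (const 0)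
  exact PrimrecRel.exists_lt_comp ((hnonzero.exists_lt_comp (hk.comp fst)).and
    (hsum.forall_lt_comp (hk.comp fst))) (Primrec.nat_pow.comp hp hk)

/-- The deviation vector, in terms of the bounded search. -/
noncomputable def searchDeviation (r s p : ℕ) : List ℤ :=
  markedDeviation (fun k => ¬ DegenerateSearch p r (r + s - 2 * k) k) r

theorem searchDeviation_eq {s : ℕ} (hrs : r ≤ s) (hp : p.Prime) :
    searchDeviation r s p = deviation r s p := by
  have : Fact p.Prime := ⟨hp⟩
  rw [deviation_eq hrs]
  exact markedDeviation_congr fun k hk => not_congr (degenerateSearch_iff hk)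

theorem primrec_searchDeviation :
    Primrec fun a : ℕ × ℕ × ℕ => searchDeviation a.1 a.2.1 a.2.2 := by
  refine primrec_markedDeviation (PrimrecPred.not ?_) fst
  refine primrecPred_degenerateSearch.comp
    (f := fun b : (ℕ × ℕ × ℕ) × ℕ => ((b.1.2.2, b.1.1), (b.1.1 + b.1.2.1 - 2 * b.2, b.2))) ?_
  have hr : Primrec fun b : (ℕ × ℕ × ℕ) × ℕ => b.1.1 := fst.comp fst
  have hs : Primrec fun b : (ℕ × ℕ × ℕ) × ℕ => b.1.2.1 := fst.comp (snd.comp fst)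
  have hp : Primrec fun b : (ℕ × ℕ × ℕ) × ℕ => b.1.2.2 := snd.comp (snd.comp fst)
  exact (hp.pair hr).pair ((nat_sub.comp (nat_add.comp hr hs)
    (nat_mul.comp (const 2) snd)).pair snd)

/-- A bound for the entries of the table. -/
def tableBound (r : ℕ) : ℕ := r + 2 * primeThreshold r * (r + 1)

theorem primrec_primeThreshold : Primrec primeThreshold := by
  have h4 : Primrec fun r : ℕ => (r * 4 ^ r) ^ r :=
    Primrec.nat_pow.comp (nat_mul.comp Primrec.id (Primrec.nat_pow.comp (const 4) Primrec.id))
      Primrec.id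
  exact nat_add.comp (nat_add.comp h4 (nat_mul.comp (const 2) Primrec.id)) (const 2)

theorem primrec_tableBound : Primrec tableBound :=
  nat_add.comp Primrec.id (nat_mul.comp (nat_mul.comp (const 2) primrec_primeThreshold) succ)

open Classical in
/-- All triples `(s, p, ε(r, s, p))` with `s` and `p` up to the bound. -/
noncomputable def deviationTable (r : ℕ) : List (ℕ × ℕ × List ℤ) :=
  (List.range (tableBound r + 1)).flatMap fun s =>
    (List.range (tableBound r + 1)).flatMap fun p =>
      if r ≤ s ∧ p.Prime then [(s, p, searchDeviation r s p)] else []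

theorem mem_deviationTable {s : ℕ} {v : List ℤ} : (s, p, v) ∈ deviationTable r ↔
    r ≤ s ∧ s ≤ tableBound r ∧ p.Prime ∧ p ≤ tableBound r ∧ v = deviation r s p := by
  simp only [deviationTable, List.mem_flatMap, List.mem_range, Nat.lt_succ_iff]
  constructor
  · rintro ⟨s', hs', p', hp', h⟩
    split_ifs at h with hc
    · obtain ⟨rfl, rfl, rfl⟩ : s = s' ∧ p = p' ∧ v = searchDeviation r s' p' := by simpa using h
      exact ⟨hc.1, hs', hc.2, hp', searchDeviation_eq hc.1 hc.2⟩
    · simp at h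
  · rintro ⟨hrs, hs, hp, hpB, rfl⟩
    exact ⟨s, hs, p, hpB, by simp [hrs, hp, searchDeviation_eq hrs hp]⟩

theorem primrec_deviationTable : Primrec deviationTable := by
  classical
  have hrange : Primrec fun r => List.range (tableBound r + 1) :=
    list_range.comp (succ.comp primrec_tableBound)
  refine list_flatMap hrange (list_flatMap (hrange.comp fst) ?_)
  have hr : Primrec fun b : (ℕ × ℕ) × ℕ => b.1.1 := fst.comp fst
  have hs : Primrec fun b : (ℕ × ℕ) × ℕ => b.1.2 := snd.comp fst
  refine Primrec.ite ((nat_le.comp hr hs).and (primrecPred_prime.comp snd)) ?_ (const [])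
  exact list_cons.comp (hs.pair (snd.pair (primrec_searchDeviation.comp (hr.pair (hs.pair snd)))))
    (const [])

end Algorithm

/-! ### The table covers all residues -/

section Coverage

variable {r s p : ℕ}

theorem leastPower_le_mul (hr : 1 ≤ r) (hp : p.Prime) : leastPower r p ≤ p * r := by
  rcases hr.eq_or_lt with rfl | hr1
  · simpa [leastPower] using hp.one_le
  · have h1 := Nat.pow_pred_clog_lt_self hp.one_lt hr1
    have h2 := Nat.clog_pos hp.one_lt hr1
    rw [leastPower, show Nat.clog p r = (Nat.clog p r).pred + 1 by
      rw [Nat.pred_eq_sub_one]; omega, pow_succ, mul_comm]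
    exact Nat.mul_le_mul_left _ h1.le

/-- Below the threshold a representative of `s` modulo the least power of `p` is in the table. Above
it, the table has the residue `k` for a prime between the threshold and twice the threshold, by
Bertrand's postulate. -/
theorem exists_mem_deviationTable (hr : 1 ≤ r) (hp : p.Prime)
    (h : ¬ StandardCongruence r s p) (hrs : r ≤ s) :
    ∃ (s' p' : ℕ) (v : List ℤ), (s', p', v) ∈ deviationTable r ∧
      (SameResidue r (primeThreshold r) s p s' p' ∨
        OppositeResidue r (primeThreshold r) s p s' p') := by
  have hN : primeThreshold r * 1 ≤ primeThreshold r * r := Nat.mul_le_mul_left _ hr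
  have hB : tableBound r = r + 2 * (primeThreshold r * r) + 2 * primeThreshold r := by
    rw [tableBound]; ring
  rcases lt_or_ge p (primeThreshold r) with hlt | hge
  · have hq : leastPower r p ≤ primeThreshold r * r :=
      (leastPower_le_mul hr hp).trans (Nat.mul_le_mul_right _ hlt.le)
    have hq0 : 0 < leastPower r p := pow_pos hp.pos _
    have hmod := Nat.mod_lt (s - r) hq0
    refine ⟨r + (s - r) % leastPower r p, p, _, mem_deviationTable.2
      ⟨by omega, by omega, hp, by omega, rfl⟩, Or.inl (Or.inl ⟨rfl, ?_⟩)⟩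
    rw [Int.natCast_modEq_iff]
    have h1 := (Nat.mod_modEq (s - r) (leastPower r p)).symm.add_left r
    rwa [Nat.add_sub_cancel' hrs] at h1
  · obtain ⟨p', hp', hlt', hle'⟩ :=
      Nat.exists_prime_lt_and_le_two_mul (primeThreshold r) (by rw [primeThreshold]; omega)
    have hrN : r ≤ primeThreshold r := by rw [primeThreshold]; omega
    obtain ⟨k, hk, hks⟩ : ∃ k : ℕ, k + 2 ≤ r ∧
        ((s : ℤ) ≡ (k : ℤ) [ZMOD p] ∨ (s : ℤ) ≡ -(k : ℤ) [ZMOD p]) := by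
      unfold StandardCongruence at h
      push Not at h
      obtain ⟨k, hk, hks⟩ := h
      exact ⟨k, hk, or_iff_not_imp_left.2 hks⟩
    have hmid : ((k + p' : ℕ) : ℤ) ≡ k [ZMOD p'] := by simp
    refine ⟨k + p', p', _, mem_deviationTable.2
      ⟨by omega, by omega, hp', by omega, rfl⟩, hks.imp (fun hs => ?_) fun hs => ?_⟩
    · exact Or.inr ⟨hge, hlt'.le, k, hk, hs, hmid⟩
    · exact Or.inr ⟨hge, hlt'.le, k, hk, hs, hmid⟩

end Coverage

theorem mainTheorem6 :
    -- the vectors `ε(r, s, p)` are well defined and depend on the field only through `p`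
    (∀ r s p : ℕ, 1 ≤ r → r ≤ s → p.Prime →
      (jordanPartition r s p).length = r ∧
        ∀ (F : Type*) [Field F] [CharP F p] (l : List ℕ),
          IsJordanPartition F r s l ↔ l = jordanPartition r s p) ∧
    -- an algorithm computes, from `r` alone, two bounds and a finite table of triples
    ∃ (N B : ℕ → ℕ) (table : ℕ → List (ℕ × ℕ × List ℤ)),
      Computable N ∧ Computable B ∧ Computable table ∧
      ∀ r : ℕ, 1 ≤ r →
        -- the table lists values `ε(r, s, p)` with `s` and `p` bounded in terms of `r`
        (∀ (s p : ℕ) (v : List ℤ), (s, p, v) ∈ table r →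
          r ≤ s ∧ s ≤ B r ∧ p.Prime ∧ p ≤ B r ∧ v = deviation r s p) ∧
        -- the rules by which further values are read off
        (∀ s p : ℕ, r ≤ s → p.Prime → StandardCongruence r s p →
          deviation r s p = standardDeviation r) ∧
        (∀ s p s' p' : ℕ, r ≤ s → p.Prime → r ≤ s' → p'.Prime →
          (SameResidue r (N r) s p s' p' → deviation r s p = deviation r s' p') ∧
          (OppositeResidue r (N r) s p s' p' →
            deviation r s p = negReverse (deviation r s' p'))) ∧
        -- the rules and the table determine every value
        (∀ s p : ℕ, r ≤ s → p.Prime →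
          (StandardCongruence r s p ∧ deviation r s p = standardDeviation r) ∨
          ∃ (s' p' : ℕ) (v : List ℤ), (s', p', v) ∈ table r ∧
            ((SameResidue r (N r) s p s' p' ∧ deviation r s p = v) ∨
              (OppositeResidue r (N r) s p s' p' ∧ deviation r s p = negReverse v))) := by
  refine ⟨fun r s p _ hrs hp => ?_, primeThreshold, tableBound, deviationTable,
    primrec_primeThreshold.to_comp, primrec_tableBound.to_comp, primrec_deviationTable.to_comp,
    fun r hr => ⟨fun s p v h => mem_deviationTable.1 h,
      fun s p hrs hp h => deviation_eq_standardDeviation hrs hp h,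
      fun s p s' p' hrs hp hrs' hp' =>
        ⟨deviation_eq_of_sameResidue hrs hrs' hp hp',
          deviation_eq_of_oppositeResidue hrs hrs' hp hp'⟩,
      fun s p hrs hp => ?_⟩⟩
  · have : Fact p.Prime := ⟨hp⟩
    refine ⟨by rw [jordanPartition_eq hrs, length_markedPartition], fun F _ _ l => ?_⟩
    rw [isJordanPartition_iff hrs, jordanPartition_eq_of_charP F hrs]
  · by_cases h : StandardCongruence r s p
    · exact Or.inl ⟨h, deviation_eq_standardDeviation hrs hp h⟩
    · obtain ⟨s', p', v, hv, hres⟩ := exists_mem_deviationTable hr hp h hrs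
      obtain ⟨hrs', -, hp', -, rfl⟩ := mem_deviationTable.1 hv
      exact Or.inr ⟨s', p', _, hv, hres.imp
        (fun h => ⟨h, deviation_eq_of_sameResidue hrs hrs' hp hp' h⟩)
        fun h => ⟨h, deviation_eq_of_oppositeResidue hrs hrs' hp hp' h⟩⟩
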